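/- Let $d\ge 2$, $\alpha=\frac{2}{d-1}$, let $q\in\mathbb S^{d-1}\subset\mathbb R^d$ be fixed and let $V\in\mathbb R^{d\times d}$. For every $n$ let $x_1,\dots,x_n$ be i.i.d. random points of $\mathbb S^{d-1}$ with common law $\rho\,d\sigma$, where $\sigma$ is the (unnormalized) surface measure and the density $\rho\ge 0$ is of class $C^2$ with $\rho(q)>0$. For $\beta_n\in\mathbb R$ put $$A_j=\frac{e^{\beta_n\langle q,x_j\rangle}}{\sum_{l=1}^n e^{\beta_n\langle q,x_l\rangle}},\qquad \mathsf{ATT}(n)=V\sum_{j=1}^n A_jx_j,\qquad \mathcal Y_n(q)=\mathsf{ATT}(n)-Vq .$$ Assume $\beta_n n^{-\alpha}\to\gamma\in(0,\infty)$. Let $\mathbb S_q^{d-2}=\{\theta\in\mathbb R^d:\langle\theta,q\rangle=0,\ \|\theta\|=1\}$, let $\nu_q$ be the uniform probability measure on it, let $\sigma_{d-2}$ be the surface area of $\mathbb S^{d-2}$ (with $\sigma_0=2$), and let $$C(q)=\frac{2^{1/\alpha}\sigma_{d-2}}{d-1}\,\rho(q).$$ Then $C(q)=\lim_{t\to0^+}t^{-1/\alpha}\,\mathbb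 P(1-\langle q,x_1\rangle\le t)$. There exists a Poisson point process $\mathcal M_\gamma$ on $[0,\infty)\times\mathbb S_q^{d-2}$ with intensity measure $$\Lambda_\gamma(dy,d\theta)=\frac{C(q)}{\alpha\gamma^{1/\alpha}}\,y^{1/\alpha-1}\,dy\,\nu_q(d\theta),$$ and for every such process, almost surely, the two integrals in $$\Xi=\frac{\int e^{-y}\sqrt{2y}\,\theta\,\mathcal M_\gamma(dy,d\theta)}{\int e^{-y}\,\mathcal M_\gamma(dy,d\theta)}$$ converge absolutely and the denominator is positive, and as $n\to\infty$ $$\sqrt{\beta_n}\,\mathcal Y_n(q)\longrightarrow V\Xi\quad\text{in distribution.}$$ In particular $\mathcal Y_n(q)\to0$ in probability, and hence $\mathsf{ATT}(n)\to Vq$ in probability. -/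

import Mathlib

open MeasureTheory ProbabilityTheory Filter Topology Metric
open scoped NNReal ENNReal Manifold RealInnerProductSpace

noncomputable section

/-- The surface measure on the unit sphere of a finite-dimensional Euclidean space `F`
(counting measure on the two unit vectors if `F` is a line). -/
def surfaceMeasure (F : Type*) [NormedAddCommGroup F] [InnerProductSpace ℝ F]
    [FiniteDimensional ℝ F] [MeasurableSpace F] [BorelSpace F] : Measure (sphere (0 : F) 1) :=
  (measureSpaceOfInnerProductSpace (E := F)).volume.toSphere

/-- The unit sphere `S^{d-1}` of `ℝ^d`. -/
abbrev USphere (d : ℕ) : Type := sphere (0 : EuclideanSpace ℝ (Fin d)) 1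

/-- The tangent space `T_q S^{d-1}`, i.e. the orthogonal complement of `q` in `ℝ^d`. -/
abbrev tangentAt {d : ℕ} (q : USphere d) : Submodule ℝ (EuclideanSpace ℝ (Fin d)) :=
  (Submodule.span ℝ {(q : EuclideanSpace ℝ (Fin d))})ᗮ

/-- The unit sphere `S_q^{d-2}` of the tangent space at `q`. -/
abbrev TangentSphere {d : ℕ} (q : USphere d) : Type := sphere (0 : tangentAt q) 1

/-- The uniform probability measure on the tangent unit sphere. -/
def uniformTangent {d : ℕ} (q : USphere d) : Measure (TangentSphere q) :=
  (surfaceMeasure (tangentAt q) Set.univ)⁻¹ • surfaceMeasure (tangentAt q)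

/-- `ρ` is a function of class `C²` on the manifold `S^{d-1}`. -/
def IsC2OnSphere (d : ℕ) (hd : 2 ≤ d) (ρ : USphere d → ℝ) : Prop :=
  haveI : Fact (Module.finrank ℝ (EuclideanSpace ℝ (Fin d)) = (d - 1) + 1) :=
    ⟨by rw [finrank_euclideanSpace_fin]; omega⟩
  ContMDiff (𝓡 (d - 1)) 𝓘(ℝ, ℝ) 2 ρ

/-- The measure `ρ dσ` on the sphere. -/
def densityLaw {d : ℕ} (ρ : USphere d → ℝ) : Measure (USphere d) :=
  (surfaceMeasure (EuclideanSpace ℝ (Fin d))).withDensity fun x => ENNReal.ofReal (ρ x)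

/-- The exponent `α = 2 / (d - 1)`. -/
def alphaExp (d : ℕ) : ℝ := 2 / ((d : ℝ) - 1)

/-- The distance-to-query `1 - ⟨q, x⟩`. -/
def distToQuery {d : ℕ} (q x : USphere d) : ℝ :=
  1 - ⟪(q : EuclideanSpace ℝ (Fin d)), (x : EuclideanSpace ℝ (Fin d))⟫

/-- The softmax attention weight of the `j`-th of the keys `x`. -/
def attnWeight {d n : ℕ} (β : ℝ) (q : USphere d) (x : Fin n → USphere d) (j : Fin n) : ℝ :=
  Real.exp (β * ⟪(q : EuclideanSpace ℝ (Fin d)), (x j : EuclideanSpace ℝ (Fin d))⟫) /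
    ∑ l, Real.exp (β * ⟪(q : EuclideanSpace ℝ (Fin d)), (x l : EuclideanSpace ℝ (Fin d))⟫)

/-- The attention output `V ∑ⱼ Aⱼ xⱼ`. -/
def attnOutput {d n : ℕ} (V : Matrix (Fin d) (Fin d) ℝ) (β : ℝ) (q : USphere d)
    (x : Fin n → USphere d) : EuclideanSpace ℝ (Fin d) :=
  V.toEuclideanLin (∑ j, attnWeight β q x j • (x j : EuclideanSpace ℝ (Fin d)))

/-- The displacement `V ∑ⱼ Aⱼ xⱼ - V q`. -/
def attnDisplacement {d n : ℕ} (V : Matrix (Fin d) (Fin d) ℝ) (β : ℝ) (q : USphere d)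
    (x : Fin n → USphere d) : EuclideanSpace ℝ (Fin d) :=
  attnOutput V β q x - V.toEuclideanLin (q : EuclideanSpace ℝ (Fin d))

/-- The local intensity `2^{1/α} σ_{d-2} ρ(q) / (d - 1)` of keys near the query, where `σ_{d-2}`
is the surface area of `S^{d-2}` and `r = ρ(q)`. -/
def localIntensity (d : ℕ) (r : ℝ) : ℝ :=
  2 ^ (1 / alphaExp d) * (surfaceMeasure (EuclideanSpace ℝ (Fin (d - 1)))).real Set.univ
    / ((d : ℝ) - 1) * r

/-- The measure `C / (α γ^{1/α}) y^{1/α - 1} dy ⊗ ν_q(dθ)` on `[0,∞) × S_q^{d-2}`, where `C` is the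
local intensity for `ρ(q) = r`. Its value on `[0,y] × B` is `C (y/γ)^{1/α} ν_q(B)`. -/
def criticalIntensity {d : ℕ} (q : USphere d) (γ r : ℝ) : Measure (ℝ≥0 × TangentSphere q) :=
  (((volume : Measure ℝ).comap ((↑) : ℝ≥0 → ℝ)).withDensity fun y => ENNReal.ofReal
    (localIntensity d r / (alphaExp d * γ ^ (1 / alphaExp d)) *
      (y : ℝ) ^ (1 / alphaExp d - 1))).prod (uniformTangent q)

/-- `M` is a Poisson point process on `X` with intensity measure `Λ`: a random boundedly finite
integer-valued measure whose value on a measurable set `B` of finite intensity is Poisson with mean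
`Λ B`, and whose values on disjoint measurable sets are independent. -/
structure IsPoissonPointProcess {X Ω : Type*} [PseudoMetricSpace X] [MeasurableSpace X]
    [MeasurableSpace Ω] (P : Measure Ω) (Λ : Measure X) (M : Ω → Measure X) : Prop where
  measurable : Measurable M
  counting : ∀ ω, ∀ B : Set X, MeasurableSet B → Bornology.IsBounded B →
    ∃ k : ℕ, M ω B = (k : ℝ≥0∞)
  hasLaw : ∀ B : Set X, MeasurableSet B → Λ B ≠ ∞ →
    HasLaw (fun ω => M ω B)
      ((poissonMeasure (Λ B).toNNReal).map fun k : ℕ => (k : ℝ≥0∞)) P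
  indep : ∀ (m : ℕ) (B : Fin m → Set X), (∀ i, MeasurableSet (B i)) →
    (Pairwise fun i j => Disjoint (B i) (B j)) → iIndepFun (fun i ω => M ω (B i)) P

/-- The integrand `e^{-y} √(2y) θ`, as a vector of `ℝ^d`. -/
def criticalNumer {d : ℕ} (q : USphere d) (z : ℝ≥0 × TangentSphere q) :
    EuclideanSpace ℝ (Fin d) :=
  (Real.exp (-(z.1 : ℝ)) * √(2 * (z.1 : ℝ))) • ((z.2 : tangentAt q) : EuclideanSpace ℝ (Fin d))

/-- The integrand `e^{-y}`. -/
def criticalDenom {d : ℕ} (q : USphere d) (z : ℝ≥0 × TangentSphere q) : ℝ :=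
  Real.exp (-(z.1 : ℝ))

/-- The functional `μ ↦ ∫ e^{-y} √(2y) θ dμ / ∫ e^{-y} dμ`. -/
def criticalRatio {d : ℕ} (q : USphere d) (μ : Measure (ℝ≥0 × TangentSphere q)) :
    EuclideanSpace ℝ (Fin d) :=
  (∫ z, criticalDenom q z ∂μ)⁻¹ • ∫ z, criticalNumer q z ∂μ

end

noncomputable section

/-! ### Poisson point processes: Campbell's formula and the characteristic functional. -/

namespace IsPoissonPointProcess

variable {X Ω : Type*} [PseudoMetricSpace X] [MeasurableSpace X] [MeasurableSpace Ω]
  {P : Measure Ω} {Λ : Measure X} {M : Ω → Measure X}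

/-! Write `D j = 1 - ⟪q, x j⟫`. Cancelling the common factor `e^β` in the softmax weights and using
that they sum to one gives `√β • 𝒴 = V (∑ e^{-β D j} √β (x j - q)) / (∑ e^{-β D j})`. So the
rescaled displacement is a fixed function, the ratio `valueRatio`, of a sum of i.i.d. vectors
`keyVector`, and it suffices to find the joint limit law of numerator and denominator. No topology
on point measures is needed: characteristic functions are enough.

By independence the characteristic function of the sum at `t` is `(1 + I n) ^ n`, where `I n` is the
mean of `e^{i⟪keyVector, t⟫} - 1` for one key. A Laplace-type localization
(`tendsto_integral_sphere_localization`) computes `lim n I n`. In the gnomonic chart `v ↦ (q + v) /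
‖q + v‖` the surface measure has the density `‖q + v‖^{-d}`. After the substitution `v = w / √β`
this density tends to `1`, `β D` tends to `‖w‖² / 2`, and `√β (x - q)` tends to `w`. The volume
factor is `n / (√β)^{d-1}`, and the critical scaling of `β` is exactly what makes it converge, to
`γ^{-1/α}`. The limit is therefore `γ^{-1/α} ρ(q)` times an integral over the tangent space, and the
coordinates `y = ‖w‖² / 2`, `θ = w / ‖w‖` turn this measure into the critical intensity
(`criticalIntensity_eq`), with `w = √(2y) θ`.

Hence the characteristic functions tend to `exp ∫ (e^{i⟪criticalVector, t⟫} - 1) dΛ`. This is the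
characteristic functional of the Poisson process (`integral_exp_integral`), that is, the
characteristic function of the numerator and denominator of `Ξ`. Lévy's theorem gives their joint
convergence. The intensity has infinite mass, so the process is almost surely nonzero and the
limiting denominator positive; the mapping theorem for almost surely continuous functions then
applies to the ratio.

The same localization applied to indicators of small caps gives the local intensity. Convergence in
probability follows because `√β → ∞`; it needs some limit law, which is why the existence of the
Poisson process is proved, by superposing independent finite pieces. -/

lemma lintegral_natCast_poissonMeasure (r : ℝ≥0) :
    ∫⁻ k : ℕ, (k : ℝ≥0∞) ∂(poissonMeasure r) = r := by
  rw [poissonMeasure, lintegral_sum_measure]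
  simp only [lintegral_smul_measure, lintegral_dirac, smul_eq_mul]
  rw [tsum_eq_zero_add' ENNReal.summable]
  simp only [CharP.cast_eq_zero, mul_zero, zero_add]
  have h (k : ℕ) : ENNReal.ofReal (Real.exp (-r) * r ^ (k + 1) / ((k + 1).factorial : ℝ)) *
      ((k + 1 : ℕ) : ℝ≥0∞) =
      r * ENNReal.ofReal (Real.exp (-r) * r ^ k / (k.factorial : ℝ)) := by
    rw [← ENNReal.ofReal_natCast, ← ENNReal.ofReal_mul (by positivity),
      ← ENNReal.ofReal_coe_nnreal, ← ENNReal.ofReal_mul (by positivity)]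
    congr 1
    rw [Nat.factorial_succ]
    push_cast
    field_simp
    ring
  simp_rw [h, ENNReal.tsum_mul_left]
  rw [← ENNReal.ofReal_tsum_of_nonneg (fun k => by positivity)
    (hasSum_one_poissonMeasure r).summable, (hasSum_one_poissonMeasure r).tsum_eq]
  simp

/-- The mean number of points in a set of finite intensity. -/
lemma lintegral_apply (hM : IsPoissonPointProcess P Λ M) {B : Set X} (hB : MeasurableSet B)
    (hfin : Λ B ≠ ∞) : ∫⁻ ω, M ω B ∂P = Λ B := by
  have h := hM.hasLaw B hB hfin
  have h1 : ∫⁻ ω, M ω B ∂P = ∫⁻ z, z ∂(P.map fun ω => M ω B) :=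
    (lintegral_map' aemeasurable_id h.aemeasurable).symm
  rw [h1, h.map_eq, lintegral_map (f := fun z : ℝ≥0∞ => z) measurable_id (by fun_prop)]
  simp only [lintegral_natCast_poissonMeasure]
  exact ENNReal.coe_toNNReal hfin

/-- The defining laws concern only sets of finite intensity, so the mean measure is identified on an
exhaustion by such sets. Campbell's formula is then integration against a `bind`. -/
lemma bind_eq [SigmaFinite Λ] (hM : IsPoissonPointProcess P Λ M) : P.bind M = Λ := by
  rw [Measure.ext_iff_of_iUnion_eq_univ (iUnion_spanningSets Λ)]
  intro i
  ext s hs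
  rw [Measure.restrict_apply hs, Measure.restrict_apply hs,
    Measure.bind_apply (hs.inter (measurableSet_spanningSets Λ i)) hM.measurable.aemeasurable,
    hM.lintegral_apply (hs.inter (measurableSet_spanningSets Λ i))]
  exact ((measure_mono Set.inter_subset_right).trans_lt (measure_spanningSets_lt_top Λ i)).ne

/-- **Campbell's formula** for nonnegative functions. -/
lemma lintegral_lintegral [SigmaFinite Λ] (hM : IsPoissonPointProcess P Λ M) {f : X → ℝ≥0∞}
    (hf : Measurable f) : ∫⁻ ω, ∫⁻ x, f x ∂(M ω) ∂P = ∫⁻ x, f x ∂Λ := by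
  rw [← Measure.lintegral_bind hM.measurable.aemeasurable hf.aemeasurable, hM.bind_eq]

lemma measurable_lintegral (hM : IsPoissonPointProcess P Λ M) {f : X → ℝ≥0∞}
    (hf : Measurable f) : Measurable fun ω => ∫⁻ x, f x ∂(M ω) :=
  (Measure.measurable_lintegral hf).comp hM.measurable

lemma ae_integrable [SigmaFinite Λ] (hM : IsPoissonPointProcess P Λ M) {E : Type*}
    [NormedAddCommGroup E] [MeasurableSpace E] [BorelSpace E] [SecondCountableTopology E]
    {f : X → E} (hf : Measurable f) (hi : Integrable f Λ) : ∀ᵐ ω ∂P, Integrable f (M ω) := by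
  have h1 : ∫⁻ ω, ∫⁻ x, ‖f x‖ₑ ∂(M ω) ∂P ≠ ∞ := by
    rw [hM.lintegral_lintegral hf.enorm]
    exact hi.2.ne
  filter_upwards [ae_lt_top (hM.measurable_lintegral hf.enorm) h1] with ω hω
  exact ⟨hf.aestronglyMeasurable, hω⟩

lemma aemeasurable_integral [SigmaFinite Λ] (hM : IsPoissonPointProcess P Λ M) {f : X → ℝ}
    (hf : Measurable f) (hi : Integrable f Λ) : AEMeasurable (fun ω => ∫ x, f x ∂(M ω)) P := by
  refine ⟨fun ω => (∫⁻ x, ENNReal.ofReal (f x) ∂(M ω)).toReal -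
    (∫⁻ x, ENNReal.ofReal (-f x) ∂(M ω)).toReal, ?_, ?_⟩
  · exact (hM.measurable_lintegral hf.ennreal_ofReal).ennreal_toReal.sub
      (hM.measurable_lintegral hf.neg.ennreal_ofReal).ennreal_toReal
  · filter_upwards [hM.ae_integrable hf hi] with ω hω
    exact integral_eq_lintegral_pos_part_sub_lintegral_neg_part hω

lemma aemeasurable_integral_euclidean [SigmaFinite Λ] (hM : IsPoissonPointProcess P Λ M)
    {ι : Type*} [Fintype ι] {f : X → EuclideanSpace ℝ ι}
    (hf : Measurable f) (hi : Integrable f Λ) : AEMeasurable (fun ω => ∫ x, f x ∂(M ω)) P := by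
  have h : AEMeasurable (fun ω => WithLp.toLp 2 (fun i => ∫ x, f x i ∂(M ω))) P := by
    refine (WithLp.measurable_toLp 2 _).comp_aemeasurable (aemeasurable_pi_lambda _ fun i => ?_)
    refine hM.aemeasurable_integral (f := fun x => f x i) ?_ ?_
    · exact (EuclideanSpace.proj (𝕜 := ℝ) i).continuous.measurable.comp hf
    · exact (EuclideanSpace.proj (𝕜 := ℝ) i).integrable_comp hi
  refine h.congr ?_
  filter_upwards [hM.ae_integrable hf hi] with ω hω
  ext i
  exact (EuclideanSpace.proj (𝕜 := ℝ) i).integral_comp_comm hω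

/-- The characteristic function of the number of points in a set of finite intensity. -/
lemma charFun_map_toReal (hM : IsPoissonPointProcess P Λ M) {B : Set X} (hB : MeasurableSet B)
    (hfin : Λ B ≠ ∞) (t : ℝ) :
    ∫ ω, Complex.exp (((M ω B).toReal * t : ℝ) * Complex.I) ∂P =
      Complex.exp ((Λ.real B : ℂ) * (Complex.exp (t * Complex.I) - 1)) := by
  have h := hM.hasLaw B hB hfin
  have h1 : ∫ ω, Complex.exp (((M ω B).toReal * t : ℝ) * Complex.I) ∂P =
      ∫ z : ℝ≥0∞, Complex.exp ((z.toReal * t : ℝ) * Complex.I) ∂(P.map fun ω => M ω B) :=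
    (integral_map (f := fun z : ℝ≥0∞ => Complex.exp ((z.toReal * t : ℝ) * Complex.I))
      h.aemeasurable (by fun_prop)).symm
  have h2 := charFun_map_cast_poissonMeasure (Λ B).toNNReal t
  rw [charFun_apply, integral_map .of_discrete (by fun_prop)] at h2
  rw [h1, h.map_eq, integral_map (by fun_prop) (by fun_prop)]
  simp only [ENNReal.toReal_natCast]
  simp_rw [Real.inner_apply] at h2
  exact h2

lemma integral_exp_finsetSum (hM : IsPoissonPointProcess P Λ M) {ι : Type*} [Fintype ι]
    {B : ι → Set X} (hB : ∀ i, MeasurableSet (B i))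
    (hd : Pairwise fun i j => Disjoint (B i) (B j)) (hfin : ∀ i, Λ (B i) ≠ ∞) (t : ι → ℝ) :
    ∫ ω, Complex.exp ((∑ i, (M ω (B i)).toReal * t i : ℝ) * Complex.I) ∂P =
      Complex.exp (∑ i, (Λ.real (B i) : ℂ) * (Complex.exp (t i * Complex.I) - 1)) := by
  -- Independence is part of the definition only for families indexed by `Fin m`, so the index type
  -- is enumerated.
  have hind : iIndepFun (fun i ω => M ω (B i)) P := by
    have h := hM.indep (Fintype.card ι) (fun k => B ((Fintype.equivFin ι).symm k))
      (fun k => hB _) (fun i j hij => hd (by simpa using hij))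
    have h' := h.precomp (Fintype.equivFin ι).injective
    simpa using h'
  have h3 := (hind.comp (fun i z => Complex.exp ((z.toReal * t i : ℝ) * Complex.I))
    (fun i => by fun_prop)).integral_fun_prod_eq_prod_integral (fun i => by
      refine Measurable.aestronglyMeasurable ?_
      have := (Measure.measurable_coe (hB i)).comp hM.measurable
      simp only [Function.comp_def] at this ⊢
      fun_prop)
  simp only [Function.comp_def] at h3
  simp_rw [hM.charFun_map_toReal (hB _) (hfin _)] at h3
  rw [Complex.exp_sum, ← h3]
  congr 1 with ω
  rw [← Complex.exp_sum, Complex.ofReal_sum, Finset.sum_mul]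

/-- This Lipschitz bound makes both sides of the characteristic functional continuous in `f` for the
`L¹(Λ)` distance. -/
lemma norm_exp_ofReal_mul_I_sub_le (a b : ℝ) :
    ‖Complex.exp (a * Complex.I) - Complex.exp (b * Complex.I)‖ ≤ |a - b| := by
  have h : Complex.exp (a * Complex.I) - Complex.exp (b * Complex.I) =
      Complex.exp (b * Complex.I) * (Complex.exp (Complex.I * ((a - b : ℝ) : ℂ)) - 1) := by
    rw [mul_sub, ← Complex.exp_add]
    push_cast
    ring_nf
  rw [h, norm_mul, Complex.norm_exp_ofReal_mul_I, one_mul]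
  exact Real.norm_exp_I_mul_ofReal_sub_one_le

lemma norm_exp_ofReal_mul_I_sub_one_le (a : ℝ) : ‖Complex.exp (a * Complex.I) - 1‖ ≤ |a| := by
  simpa using norm_exp_ofReal_mul_I_sub_le a 0

lemma integrable_exp_mul_I_sub_one {X : Type*} [MeasurableSpace X] {Λ : Measure X}
    {f : X → ℝ} (hi : Integrable f Λ) :
    Integrable (fun x => Complex.exp (f x * Complex.I) - 1) Λ := by
  refine hi.norm.mono' ?_ (ae_of_all _ fun x => norm_exp_ofReal_mul_I_sub_one_le (f x))
  exact (by fun_prop : Continuous fun a : ℝ => Complex.exp (a * Complex.I) - 1)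
    |>.comp_aestronglyMeasurable hi.1

/-- The fibres over nonzero values are disjoint and of finite intensity, so the counts on them are
independent Poisson variables. The fibre over `0` may have infinite intensity, but it contributes to
neither side and is filtered out. -/
lemma integral_exp_simpleFunc [SigmaFinite Λ] (hM : IsPoissonPointProcess P Λ M)
    (s : SimpleFunc X ℝ) (hi : Integrable s Λ) :
    ∫ ω, Complex.exp ((∫ x, s x ∂(M ω) : ℝ) * Complex.I) ∂P =
      Complex.exp (∫ x, (Complex.exp (s x * Complex.I) - 1) ∂Λ) := by
  have hmem (y : ↥(s.range.filter (· ≠ 0))) : (y : ℝ) ≠ 0 := (Finset.mem_filter.1 y.2).2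
  have key := hM.integral_exp_finsetSum (B := fun y : ↥(s.range.filter (· ≠ 0)) => s ⁻¹' {(y : ℝ)})
    (fun y => s.measurableSet_fiber _)
    (fun y z hyz => Disjoint.preimage _ (by simpa using fun h => hyz (Subtype.ext h)))
    (fun y => (SimpleFunc.measure_preimage_lt_top_of_integrable s hi (hmem y)).ne)
    (fun y => (y : ℝ))
  have h1 : ∫ x, (Complex.exp (s x * Complex.I) - 1) ∂Λ =
      ∑ y : ↥(s.range.filter (· ≠ 0)), (Λ.real (s ⁻¹' {(y : ℝ)}) : ℂ) *
        (Complex.exp ((y : ℝ) * Complex.I) - 1) := by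
    have h2 := SimpleFunc.map_integral (μ := Λ) s (fun a : ℝ => Complex.exp (a * Complex.I) - 1) hi
      (by simp)
    rw [SimpleFunc.integral_eq_integral
      (s.map fun a : ℝ => Complex.exp (a * Complex.I) - 1)
      (integrable_exp_mul_I_sub_one hi)] at h2
    simp only [SimpleFunc.coe_map, Function.comp_def] at h2
    rw [h2, Finset.sum_coe_sort (s.range.filter (· ≠ 0))
      (fun y => (Λ.real (s ⁻¹' {y}) : ℂ) * (Complex.exp (y * Complex.I) - 1)),
      Finset.sum_filter_of_ne]
    · simp
    · rintro y - hy rfl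
      simp at hy
  rw [h1, ← key]
  refine integral_congr_ae ?_
  filter_upwards [hM.ae_integrable s.measurable hi] with ω hω
  rw [← SimpleFunc.integral_eq_integral _ hω,
    SimpleFunc.integral_eq_sum_filter, Finset.sum_coe_sort (s.range.filter (· ≠ 0))
      (fun y => (M ω (s ⁻¹' {y})).toReal * y)]
  simp [Measure.real]

/-- The characteristic functional of a Poisson point process. -/
theorem integral_exp_integral [IsProbabilityMeasure P] [SigmaFinite Λ]
    (hM : IsPoissonPointProcess P Λ M) {f : X → ℝ} (hf : Measurable f) (hi : Integrable f Λ) :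
    ∫ ω, Complex.exp ((∫ x, f x ∂(M ω) : ℝ) * Complex.I) ∂P =
      Complex.exp (∫ x, (Complex.exp (f x * Complex.I) - 1) ∂Λ) := by
  set s : ℕ → SimpleFunc X ℝ :=
    fun n => SimpleFunc.approxOn f hf (Set.range f ∪ {0}) 0 (by simp) n with hs
  have hsi (n : ℕ) : Integrable (s n) Λ := SimpleFunc.integrable_approxOn_range hf hi n
  have hlim : Tendsto (fun n => ∫⁻ x, ‖s n x - f x‖ₑ ∂Λ) atTop (𝓝 0) :=
    SimpleFunc.tendsto_approxOn_range_L1_enorm hf hi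
  have hlim' : Tendsto (fun n => (∫⁻ x, ‖s n x - f x‖ₑ ∂Λ).toReal) atTop (𝓝 0) := by
    simpa [Function.comp_def] using (ENNReal.tendsto_toReal ENNReal.zero_ne_top).comp hlim
  have hfinn (n : ℕ) : ∫⁻ x, ‖s n x - f x‖ₑ ∂Λ ≠ ∞ := ((hsi n).sub hi).2.ne
  -- The difference is at most the mean of `∫ |s n - f| dM`, which Campbell's formula turns into `∫
  -- |s n - f| dΛ`.
  have hL : Tendsto (fun n => ∫ ω, Complex.exp ((∫ x, s n x ∂(M ω) : ℝ) * Complex.I) ∂P) atTop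
      (𝓝 (∫ ω, Complex.exp ((∫ x, f x ∂(M ω) : ℝ) * Complex.I) ∂P)) := by
    rw [tendsto_iff_norm_sub_tendsto_zero]
    refine squeeze_zero (fun _ => norm_nonneg _) (fun n => ?_) hlim'
    have hint {g : X → ℝ} (hg : Measurable g) (hgi : Integrable g Λ) :
        Integrable (fun ω => Complex.exp ((∫ x, g x ∂(M ω) : ℝ) * Complex.I)) P := by
      refine Integrable.of_bound (C := 1) ?_ (ae_of_all _ fun ω => ?_)
      · exact (by fun_prop : Continuous fun a : ℝ => Complex.exp (a * Complex.I))
          |>.comp_aestronglyMeasurable (hM.aemeasurable_integral hg hgi).aestronglyMeasurable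
      · rw [Complex.norm_exp_ofReal_mul_I]
    rw [← integral_sub (hint (s n).measurable (hsi n)) (hint hf hi)]
    have hm : Measurable fun x => ‖s n x - f x‖ₑ := ((s n).measurable.sub hf).enorm
    have hmean := hM.lintegral_lintegral hm
    refine (norm_integral_le_of_norm_le
      (g := fun ω => (∫⁻ x, ‖s n x - f x‖ₑ ∂(M ω)).toReal) ?_ ?_).trans_eq ?_
    · exact integrable_toReal_of_lintegral_ne_top (hM.measurable_lintegral hm).aemeasurable
        (by rw [hmean]; exact hfinn n)
    · filter_upwards [hM.ae_integrable (s n).measurable (hsi n), hM.ae_integrable hf hi]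
        with ω h1 h2
      refine (norm_exp_ofReal_mul_I_sub_le _ _).trans ?_
      rw [← integral_sub h1 h2, ← Real.norm_eq_abs]
      refine (norm_integral_le_integral_norm _).trans_eq ?_
      exact integral_norm_eq_lintegral_enorm (h1.sub h2).1
    · rw [integral_toReal (hM.measurable_lintegral hm).aemeasurable
        (ae_lt_top (hM.measurable_lintegral hm) (by rw [hmean]; exact hfinn n)), hmean]
  have hR : Tendsto (fun n => Complex.exp (∫ x, (Complex.exp (s n x * Complex.I) - 1) ∂Λ)) atTop
      (𝓝 (Complex.exp (∫ x, (Complex.exp (f x * Complex.I) - 1) ∂Λ))) := by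
    refine (Complex.continuous_exp.tendsto _).comp ?_
    rw [tendsto_iff_norm_sub_tendsto_zero]
    refine squeeze_zero (fun _ => norm_nonneg _) (fun n => ?_) hlim'
    rw [← integral_sub (integrable_exp_mul_I_sub_one (hsi n)) (integrable_exp_mul_I_sub_one hi)]
    refine (norm_integral_le_of_norm_le (g := fun x => ‖s n x - f x‖) ((hsi n).sub hi).norm
      (ae_of_all _ fun x => ?_)).trans_eq ?_
    · rw [sub_sub_sub_cancel_right]
      exact norm_exp_ofReal_mul_I_sub_le _ _
    · exact integral_norm_eq_lintegral_enorm ((hsi n).sub hi).1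
  refine tendsto_nhds_unique hL (hR.congr fun n => ?_)
  exact (hM.integral_exp_simpleFunc (s n) (hsi n)).symm

/-- A Poisson point process of infinite total intensity is almost surely nonzero. -/
lemma ae_ne_zero [SigmaFinite Λ] [IsProbabilityMeasure P] (hM : IsPoissonPointProcess P Λ M)
    (htop : Λ Set.univ = ∞) : ∀ᵐ ω ∂P, M ω ≠ 0 := by
  -- A zero process has no point in any spanning set; the void probabilities `e^{-Λ(S)}` of these
  -- sets tend to `0`.
  have hle (i : ℕ) : P {ω | M ω = 0} ≤ ENNReal.ofReal (Real.exp (-Λ.real (spanningSets Λ i))) := by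
    have hfin := (measure_spanningSets_lt_top Λ i).ne
    have h := hM.hasLaw _ (measurableSet_spanningSets Λ i) hfin
    have h1 := h.measure_eq (p := fun z => z = 0) (measurableSet_singleton 0)
    rw [Measure.map_apply (by fun_prop) (s := {x | x = 0}) (measurableSet_singleton 0)] at h1
    have h2 : ((fun k : ℕ => (k : ℝ≥0∞)) ⁻¹' {x | x = 0}) = {0} := by
      ext k; simp
    have h3 := poissonMeasure_singleton (Λ (spanningSets Λ i)).toNNReal 0
    rw [h2, h3] at h1
    refine (measure_mono fun ω (hω : M ω = 0) => ?_).trans (h1.le.trans ?_)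
    · simp [hω]
    · simp [Measure.real, ENNReal.toReal]
  have hlim : Tendsto (fun i => ENNReal.ofReal (Real.exp (-Λ.real (spanningSets Λ i)))) atTop
      (𝓝 0) := by
    have h1 : Tendsto (fun i => Λ (spanningSets Λ i)) atTop (𝓝 ∞) := by
      have := tendsto_measure_iUnion_atTop (μ := Λ) (monotone_spanningSets Λ)
      rwa [iUnion_spanningSets, htop] at this
    have h2 : Tendsto (fun i => Λ.real (spanningSets Λ i)) atTop atTop := by
      rw [← ENNReal.tendsto_ofReal_nhds_top]
      refine h1.congr fun i => ?_
      rw [Measure.real, ENNReal.ofReal_toReal (measure_spanningSets_lt_top Λ i).ne]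
    have h3 := ENNReal.tendsto_ofReal (Real.tendsto_exp_atBot.comp
      (tendsto_neg_atTop_atBot.comp h2))
    simpa using h3
  have h0 : P {ω | M ω = 0} = 0 := le_antisymm (ge_of_tendsto' hlim hle) bot_le
  simpa [ae_iff] using h0

end IsPoissonPointProcess

/-! ### Construction of Poisson processes by superposing independent finite pieces. -/

namespace PoissonConstruction

variable {X : Type*} [MeasurableSpace X]

/-- The sum of the values of `g` at the first `N` points of the sequence `x`, for `p = (N, x)`. -/
def pieceSum {R : Type*} [AddCommMonoid R] (g : X → R) (p : ℕ × (ℕ → X)) : R :=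
  ∑ j ∈ Finset.range p.1, g (p.2 j)

lemma measurable_pieceSum {R : Type*} [AddCommMonoid R] [MeasurableSpace R] [MeasurableAdd₂ R]
    {g : X → R} (hg : Measurable g) : Measurable (pieceSum g) := by
  refine measurable_from_prod_countable_right fun n => ?_
  simp only [pieceSum]
  exact Finset.measurable_sum _ fun j _ => hg.comp (measurable_pi_apply j)

/-- A Poisson number of mean `r` together with an independent sequence of independent points of
law `π`. -/
def pieceLaw (r : ℝ≥0) (π : Measure X) [IsProbabilityMeasure π] : Measure (ℕ × (ℕ → X)) :=
  (poissonMeasure r).prod (Measure.infinitePi fun _ : ℕ => π)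

instance (r : ℝ≥0) (π : Measure X) [IsProbabilityMeasure π] :
    IsProbabilityMeasure (pieceLaw r π) := by
  unfold pieceLaw; infer_instance

/-- Compound Poisson formula: given `N = n` the sum has characteristic function `φ ^ n`, and
averaging over `N` sums an exponential series. -/
lemma integral_exp_pieceSum (r : ℝ≥0) (π : Measure X) [IsProbabilityMeasure π] {g : X → ℝ}
    (hg : Measurable g) :
    ∫ p, Complex.exp (pieceSum g p * Complex.I) ∂(pieceLaw r π) =
      Complex.exp (r * ((∫ x, Complex.exp (g x * Complex.I) ∂π) - 1)) := by
  have hint : Integrable (fun p => Complex.exp (pieceSum g p * Complex.I)) (pieceLaw r π) := by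
    refine Integrable.of_bound (C := 1) ?_ (ae_of_all _ fun p => ?_)
    · have := measurable_pieceSum hg
      exact Measurable.aestronglyMeasurable (by fun_prop)
    · rw [Complex.norm_exp_ofReal_mul_I]
  have hslice (n : ℕ) : ∫ x : ℕ → X, Complex.exp (pieceSum g (n, x) * Complex.I)
      ∂(Measure.infinitePi fun _ : ℕ => π) = (∫ x, Complex.exp (g x * Complex.I) ∂π) ^ n := by
    have hind := (iIndepFun_infinitePi (P := fun _ : ℕ => π)
      (X := fun (_ : ℕ) x => Complex.exp (g x * Complex.I)) (fun _ => by fun_prop)).precomp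
      (Fin.val_injective (n := n))
    have h := hind.integral_fun_prod_eq_prod_integral (fun j => by
      exact Measurable.aestronglyMeasurable (by fun_prop))
    have hev (j : Fin n) : ∫ x : ℕ → X, Complex.exp (g (x j) * Complex.I)
        ∂(Measure.infinitePi fun _ : ℕ => π) = ∫ x, Complex.exp (g x * Complex.I) ∂π := by
      have h1 := integral_map (μ := Measure.infinitePi fun _ : ℕ => π)
        (φ := fun x : ℕ → X => x j) (f := fun x => Complex.exp (g x * Complex.I))
        (measurable_pi_apply _).aemeasurable (Measurable.aestronglyMeasurable (by fun_prop))
      rw [Measure.infinitePi_map_eval (fun _ : ℕ => π) (j : ℕ)] at h1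
      exact h1.symm
    simp only [hev, Finset.prod_const, Finset.card_univ, Fintype.card_fin] at h
    rw [← h]
    congr 1 with x
    rw [← Complex.exp_sum, pieceSum, Finset.sum_range, Complex.ofReal_sum, Finset.sum_mul]
  rw [pieceLaw] at hint ⊢
  rw [integral_prod _ hint]
  simp only [hslice]
  rw [integral_poissonMeasure]
  set φ := ∫ x, Complex.exp (g x * Complex.I) ∂π
  have h1 (a : ℕ) : (Real.exp (-r) * r ^ a / (a.factorial : ℝ)) • φ ^ a =
      (Real.exp (-r) : ℂ) * ((r * φ) ^ a / (a.factorial : ℂ)) := by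
    rw [Complex.real_smul, mul_pow]
    push_cast
    ring
  simp_rw [h1]
  rw [tsum_mul_left, (NormedSpace.expSeries_div_hasSum_exp (r * φ)).tsum_eq,
    ← Complex.exp_eq_exp_ℂ, Complex.ofReal_exp, ← Complex.exp_add]
  push_cast
  ring_nf

lemma exists_isProbabilityMeasure_smul_eq [Nonempty X] (μ : Measure X) [IsFiniteMeasure μ] :
    ∃ π : Measure X, IsProbabilityMeasure π ∧ μ Set.univ • π = μ := by
  by_cases h : μ Set.univ = 0
  -- The zero measure cannot be normalized; with factor `0` any probability measure serves.
  · exact ⟨Measure.dirac (Classical.arbitrary X), inferInstance, by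
      rw [h, zero_smul, Measure.measure_univ_eq_zero.1 h]⟩
  · refine ⟨(μ Set.univ)⁻¹ • μ, ⟨?_⟩, ?_⟩
    · rw [Measure.smul_apply, smul_eq_mul, ENNReal.inv_mul_cancel h (measure_ne_top _ _)]
    · rw [smul_smul, ENNReal.mul_inv_cancel h (measure_ne_top _ _), one_smul]

/-- At most one indicator is nonzero at `x`, so the exponential becomes linear in the indicators.
This is what makes the Poisson exponents additive over disjoint sets. -/
lemma exp_sum_indicator_mul_I {X ι : Type*} [Fintype ι] {B : ι → Set X}
    (hd : Pairwise fun i j => Disjoint (B i) (B j)) (t : ι → ℝ) (x : X) :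
    Complex.exp ((∑ i, (B i).indicator (fun _ => t i) x : ℝ) * Complex.I) =
      1 + ∑ i, (B i).indicator (fun _ => Complex.exp (t i * Complex.I) - 1) x := by
  classical
  by_cases h : ∃ i, x ∈ B i
  · obtain ⟨i, hi⟩ := h
    have hn (j : ι) (hj : j ≠ i) : x ∉ B j := fun hxj => (hd hj).le_bot ⟨hxj, hi⟩
    rw [Finset.sum_eq_single i (fun j _ hj => by simp [hn j hj]) (by simp),
      Finset.sum_eq_single i (fun j _ hj => by simp [hn j hj]) (by simp)]
    simp [hi]
  · push Not at h
    simp [h]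

section

variable (S : ℕ → Set X) (r : ℕ → ℝ≥0) (π : ℕ → Measure X) [∀ k, IsProbabilityMeasure (π k)]

/-- The number of points of the first `K` pieces that lie in `B`. -/
def partialCount (K : ℕ) (B : Set X) (ω : ℕ → ℕ × (ℕ → X)) : ℕ :=
  ∑ k ∈ Finset.range K, pieceSum ((B ∩ S k).indicator (1 : X → ℕ)) (ω k)

variable {S}

lemma measurable_partialCount (hS : ∀ k, MeasurableSet (S k)) (K : ℕ) {B : Set X}
    (hB : MeasurableSet B) : Measurable (partialCount S K B) :=
  Finset.measurable_sum _ fun k _ => (measurable_pieceSum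
    (measurable_one.indicator (hB.inter (hS k)))).comp (measurable_pi_apply k)

variable {r π} {Λ : Measure X}

/-- A weighted sum of counts is a sum over pieces of independent compound Poisson sums. Its exponent
is linear in the masses `Λ(B i ∩ S k)`, so the product over pieces `k` regroups as a product over
sets `i`. This one identity yields both the Poisson law of a count (one set) and the independence of
the counts (the factorization). -/
lemma integral_exp_partialCount (hS : ∀ k, MeasurableSet (S k))
    (hΛ : ∀ k, (r k : ℝ≥0∞) • π k = Λ.restrict (S k)) {ι : Type*} [Fintype ι] {B : ι → Set X}
    (hB : ∀ i, MeasurableSet (B i)) (hd : Pairwise fun i j => Disjoint (B i) (B j)) (K : ℕ)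
    (t : ι → ℝ) :
    ∫ ω, Complex.exp ((∑ i, partialCount S K (B i) ω * t i : ℝ) * Complex.I)
      ∂(Measure.infinitePi fun k => pieceLaw (r k) (π k)) =
      ∏ i, Complex.exp ((∑ k ∈ Finset.range K, Λ.real (B i ∩ S k) : ℝ) *
        (Complex.exp (t i * Complex.I) - 1)) := by
  set g : ℕ → X → ℝ := fun k x => ∑ i, (B i ∩ S k).indicator (fun _ => t i) x with hg_def
  have hg (k : ℕ) : Measurable (g k) := Finset.measurable_sum _ fun i _ =>
    measurable_const.indicator ((hB i).inter (hS k))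
  have hpiece (k : ℕ) : ∫ p, Complex.exp (pieceSum (g k) p * Complex.I) ∂(pieceLaw (r k) (π k)) =
      Complex.exp (∑ i, (Λ.real (B i ∩ S k) : ℂ) * (Complex.exp (t i * Complex.I) - 1)) := by
    rw [integral_exp_pieceSum _ _ (hg k)]
    congr 1
    have hd' : Pairwise fun i j => Disjoint (B i ∩ S k) (B j ∩ S k) := fun i j hij =>
      (hd hij).mono Set.inter_subset_left Set.inter_subset_left
    simp only [hg_def, exp_sum_indicator_mul_I hd' t]
    have hi (i : ι) : Integrable (fun x => (B i ∩ S k).indicator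
        (fun _ => Complex.exp (t i * Complex.I) - 1) x) (π k) :=
      (integrable_const _).indicator ((hB i).inter (hS k))
    rw [integral_add (integrable_const _) (integrable_finsetSum _ fun i _ => hi i),
      integral_finsetSum _ fun i _ => hi i]
    simp only [integral_const, probReal_univ, one_smul, add_sub_cancel_left]
    rw [Finset.mul_sum]
    refine Finset.sum_congr rfl fun i _ => ?_
    rw [integral_indicator ((hB i).inter (hS k)), setIntegral_const]
    have h1 : Λ.real (B i ∩ S k) = r k * (π k).real (B i ∩ S k) := by
      have := congrArg (fun μ : Measure X => μ.real (B i ∩ S k)) (hΛ k)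
      simp only [Measure.real, Measure.smul_apply, smul_eq_mul,
        Measure.restrict_apply ((hB i).inter (hS k)), ENNReal.toReal_mul,
        Set.inter_assoc, Set.inter_self, ENNReal.coe_toReal] at this
      exact this.symm
    rw [h1, Complex.real_smul]
    push_cast
    ring
  have hind := (iIndepFun_infinitePi (P := fun k => pieceLaw (r k) (π k))
    (X := fun k p => Complex.exp (pieceSum (g k) p * Complex.I)) (fun k => by
      have := measurable_pieceSum (hg k)
      fun_prop)).precomp (Fin.val_injective (n := K))
  have h := hind.integral_fun_prod_eq_prod_integral (fun k => by
    have := measurable_pieceSum (hg k)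
    exact Measurable.aestronglyMeasurable (by fun_prop))
  have hev (k : ℕ) : ∫ ω, Complex.exp (pieceSum (g k) (ω k) * Complex.I)
      ∂(Measure.infinitePi fun k => pieceLaw (r k) (π k)) =
      ∫ p, Complex.exp (pieceSum (g k) p * Complex.I) ∂(pieceLaw (r k) (π k)) := by
    have := measurable_pieceSum (hg k)
    have h1 := integral_map (μ := Measure.infinitePi fun k => pieceLaw (r k) (π k))
      (φ := fun ω => ω k) (f := fun p => Complex.exp (pieceSum (g k) p * Complex.I))
      (measurable_pi_apply _).aemeasurable (Measurable.aestronglyMeasurable (by fun_prop))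
    rw [Measure.infinitePi_map_eval (fun k => pieceLaw (r k) (π k)) k] at h1
    exact h1.symm
  simp only [hev, hpiece] at h
  have hR : ∏ i, Complex.exp ((∑ k ∈ Finset.range K, Λ.real (B i ∩ S k) : ℝ) *
        (Complex.exp (t i * Complex.I) - 1)) =
      ∏ k : Fin K, Complex.exp (∑ i, (Λ.real (B i ∩ S k) : ℂ) *
        (Complex.exp (t i * Complex.I) - 1)) := by
    rw [← Complex.exp_sum, ← Complex.exp_sum, Finset.sum_comm]
    congr 1
    refine Finset.sum_congr rfl fun i _ => ?_
    rw [Finset.sum_range, Complex.ofReal_sum, Finset.sum_mul]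
  rw [hR, ← h]
  congr 1 with ω
  rw [← Complex.exp_sum, ← Finset.sum_mul, ← Complex.ofReal_sum]
  congr 3
  simp only [partialCount, pieceSum, hg_def]
  rw [← Finset.sum_range (f := fun k => ∑ j ∈ Finset.range (ω k).1,
    ∑ i, (B i ∩ S k).indicator (fun _ => t i) ((ω k).2 j))]
  push_cast
  simp_rw [Finset.sum_mul]
  rw [Finset.sum_comm]
  refine Finset.sum_congr rfl fun k _ => ?_
  rw [Finset.sum_comm]
  refine Finset.sum_congr rfl fun j _ => Finset.sum_congr rfl fun i _ => ?_
  by_cases hx : (ω k).2 j ∈ B i ∩ S k <;> simp [hx]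

lemma charFun_map_partialCount (hS : ∀ k, MeasurableSet (S k))
    (hΛ : ∀ k, (r k : ℝ≥0∞) • π k = Λ.restrict (S k)) {B : Set X} (hB : MeasurableSet B) (K : ℕ)
    (t : ℝ) :
    charFun ((Measure.infinitePi fun k => pieceLaw (r k) (π k)).map
      fun ω => (partialCount S K B ω : ℝ)) t =
      Complex.exp ((∑ k ∈ Finset.range K, Λ.real (B ∩ S k) : ℝ) *
        (Complex.exp (t * Complex.I) - 1)) := by
  have hm := measurable_partialCount hS K hB
  rw [charFun_apply, integral_map (by fun_prop) (by fun_prop)]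
  have h := integral_exp_partialCount hS hΛ (ι := Unit) (B := fun _ => B) (fun _ => hB)
    (fun i j hij => (hij rfl).elim) K (fun _ => t)
  simp only [Finset.univ_unique, Finset.sum_singleton, Finset.prod_singleton] at h
  simp_rw [Real.inner_apply]
  exact h

lemma iIndepFun_partialCount (hS : ∀ k, MeasurableSet (S k))
    (hΛ : ∀ k, (r k : ℝ≥0∞) • π k = Λ.restrict (S k)) {ι : Type*} [Fintype ι] {B : ι → Set X}
    (hB : ∀ i, MeasurableSet (B i)) (hd : Pairwise fun i j => Disjoint (B i) (B j)) (K : ℕ) :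
    iIndepFun (fun i ω => (partialCount S K (B i) ω : ℝ))
      (Measure.infinitePi fun k => pieceLaw (r k) (π k)) := by
  have hm (i : ι) := measurable_partialCount hS K (hB i)
  rw [iIndepFun_iff_charFun_pi (fun i => by have := hm i; fun_prop)]
  intro t
  simp_rw [charFun_map_partialCount hS hΛ (hB _)]
  rw [← integral_exp_partialCount hS hΛ hB hd K (fun i => t i), charFun_apply,
    integral_map (by fun_prop) (by fun_prop)]
  congr 1 with ω
  simp [PiLp.inner_apply, mul_comm]

lemma hasLaw_partialCount (hS : ∀ k, MeasurableSet (S k))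
    (hΛ : ∀ k, (r k : ℝ≥0∞) • π k = Λ.restrict (S k)) {B : Set X} (hB : MeasurableSet B) (K : ℕ) :
    HasLaw (fun ω => (partialCount S K B ω : ℝ≥0∞))
      ((poissonMeasure (∑ k ∈ Finset.range K, Λ.real (B ∩ S k)).toNNReal).map
        fun k : ℕ => (k : ℝ≥0∞)) (Measure.infinitePi fun k => pieceLaw (r k) (π k)) := by
  have hm := measurable_partialCount hS K hB
  refine ⟨by fun_prop, ?_⟩
  have h : (Measure.infinitePi fun k => pieceLaw (r k) (π k)).map
      (fun ω => (partialCount S K B ω : ℝ)) =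
      (poissonMeasure (∑ k ∈ Finset.range K, Λ.real (B ∩ S k)).toNNReal).map
        (Nat.cast : ℕ → ℝ) := by
    have : IsProbabilityMeasure ((Measure.infinitePi fun k => pieceLaw (r k) (π k)).map
      (fun ω => (partialCount S K B ω : ℝ))) := Measure.isProbabilityMeasure_map (by fun_prop)
    refine Measure.ext_of_charFun ?_
    ext t
    rw [charFun_map_partialCount hS hΛ hB, charFun_map_cast_poissonMeasure]
    have h0 : 0 ≤ ∑ k ∈ Finset.range K, Λ.real (B ∩ S k) :=
      Finset.sum_nonneg fun _ _ => measureReal_nonneg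
    rw [← Real.coe_toNNReal _ h0]
    simp
  -- Characteristic functions identify the law on `ℝ`; `ENNReal.ofReal` carries it to the extended
  -- half-line.
  have h' := congrArg (Measure.map ENNReal.ofReal) h
  rw [Measure.map_map (by fun_prop) (by fun_prop), Measure.map_map (by fun_prop) (by fun_prop)]
    at h'
  simpa [Function.comp_def] using h'

end

/-- Independence passes to monotone limits. -/
lemma iIndepFun_iSup {Ω ι : Type*} [MeasurableSpace Ω] {P : Measure Ω} [IsProbabilityMeasure P]
    {Y : ℕ → ι → Ω → ℝ≥0∞} (hm : ∀ K i, Measurable (Y K i))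
    (hmono : ∀ i ω, Monotone fun K => Y K i ω) (h : ∀ K, iIndepFun (Y K) P) :
    iIndepFun (fun i ω => ⨆ K, Y K i ω) P := by
  have hms (i : ι) : Measurable fun ω => ⨆ K, Y K i ω := Measurable.iSup fun K => hm K i
  -- The sets `{⨆ K, Y K i ≤ a}` form a generating π-system, and each is the decreasing intersection
  -- over `K` of `{Y K i ≤ a}`. The product formula thus passes to the limit by continuity from
  -- above.
  refine iIndepSets.iIndep (fun i => (hms i).comap_le)
    (fun i => Set.preimage (fun ω => ⨆ K, Y K i ω) '' Set.range Set.Iic)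
    (fun i => ?_) (fun i => ?_) ?_
  · have := (isPiSystem_Iic (α := ℝ≥0∞)).comap (fun ω => ⨆ K, Y K i ω)
    exact this
  · rw [BorelSpace.measurable_eq (α := ℝ≥0∞), borel_eq_generateFrom_Iic,
      MeasurableSpace.comap_generateFrom]
  · rw [iIndepSets_iff]
    intro s f hf
    have hex (i : ι) : ∃ a : ℝ≥0∞, i ∈ s → f i = {ω | ⨆ K, Y K i ω ≤ a} := by
      by_cases hi : i ∈ s
      · obtain ⟨_, ⟨a, rfl⟩, hfa⟩ := hf i hi
        exact ⟨a, fun _ => hfa.symm⟩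
      · exact ⟨0, fun h => (hi h).elim⟩
    choose a ha using hex
    have hlim1 : Tendsto (fun K => P (⋂ i ∈ s, {ω | Y K i ω ≤ a i})) atTop
        (𝓝 (P (⋂ i ∈ s, f i))) := by
      have heq : ⋂ i ∈ s, f i = ⋂ K, ⋂ i ∈ s, {ω | Y K i ω ≤ a i} := by
        rw [Set.iInter_comm]
        refine Set.iInter_congr fun i => ?_
        rw [Set.iInter_comm]
        refine Set.iInter_congr fun hi => ?_
        rw [ha i hi]
        ext ω
        simp
      rw [heq]
      refine tendsto_measure_iInter_atTop (fun K => ?_) ?_ ⟨0, measure_ne_top _ _⟩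
      · exact (Finset.measurableSet_biInter s fun i _ =>
          measurableSet_le (hm K i) measurable_const).nullMeasurableSet
      · intro K L hKL
        exact Set.iInter₂_mono fun i _ ω hω => (hmono i ω hKL).trans hω
    have hlim2 : Tendsto (fun K => ∏ i ∈ s, P {ω | Y K i ω ≤ a i}) atTop
        (𝓝 (∏ i ∈ s, P (f i))) := by
      refine ENNReal.tendsto_finsetProd_of_ne_top _ (fun i hi => ?_) (fun i _ => measure_ne_top _ _)
      have heq : f i = ⋂ K, {ω | Y K i ω ≤ a i} := by
        rw [ha i hi]
        ext ω
        simp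
      rw [heq]
      refine tendsto_measure_iInter_atTop (fun K => ?_) ?_ ⟨0, measure_ne_top _ _⟩
      · exact (measurableSet_le (hm K i) measurable_const).nullMeasurableSet
      · exact fun K L hKL ω hω => (hmono i ω hKL).trans hω
    refine tendsto_nhds_unique hlim1 (hlim2.congr fun K => ?_)
    exact ((iIndepFun_iff_measure_inter_preimage_eq_mul.1 (h K)) s
      (sets := fun i => Set.Iic (a i)) (fun i _ => measurableSet_Iic)).symm

/-- Finite sets suffice later, because a distribution function at a finite level only sees finitely
many integers. -/
lemma tendsto_poissonMeasure_finset {ι : Type*} {l : Filter ι} {r : ι → ℝ≥0} {r₀ : ℝ≥0}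
    (h : Tendsto r l (𝓝 r₀)) (s : Finset ℕ) :
    Tendsto (fun i => poissonMeasure (r i) s) l (𝓝 (poissonMeasure r₀ s)) := by
  simp_rw [← sum_measure_singleton, poissonMeasure_singleton]
  refine tendsto_finsetSum _ fun k _ => ENNReal.tendsto_ofReal ?_
  have h' : Tendsto (fun i => (r i : ℝ)) l (𝓝 r₀) := (NNReal.continuous_coe.tendsto _).comp h
  exact ((Real.continuous_exp.tendsto _).comp h'.neg).mul (h'.pow k) |>.div_const _

/-- The point process that puts the first `N` points of the `k`-th sequence into the `k`-th
piece. -/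
def pointProcess (S : ℕ → Set X) (ω : ℕ → ℕ × (ℕ → X)) : Measure X :=
  Measure.sum fun k => (∑ j ∈ Finset.range (ω k).1, Measure.dirac ((ω k).2 j)).restrict (S k)

lemma pointProcess_apply {S : ℕ → Set X} (hS : ∀ k, MeasurableSet (S k)) {B : Set X}
    (hB : MeasurableSet B) (ω : ℕ → ℕ × (ℕ → X)) :
    pointProcess S ω B = ⨆ K, (partialCount S K B ω : ℝ≥0∞) := by
  rw [pointProcess, Measure.sum_apply _ hB, ENNReal.tsum_eq_iSup_nat]
  congr 1 with K
  simp only [partialCount, pieceSum, Nat.cast_sum]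
  refine Finset.sum_congr rfl fun k _ => ?_
  rw [Measure.restrict_apply hB, Measure.finsetSum_apply]
  refine Finset.sum_congr rfl fun j _ => ?_
  rw [Measure.dirac_apply' _ (hB.inter (hS k))]
  by_cases hx : (ω k).2 j ∈ B ∩ S k <;> simp [hx]

end PoissonConstruction

open PoissonConstruction in
/-- Existence of Poisson point processes for an intensity which is finite on the pieces of a locally
finite measurable partition. -/
theorem exists_isPoissonPointProcess {X : Type} [PseudoMetricSpace X] [MeasurableSpace X]
    [Nonempty X] (Λ : Measure X) (S : ℕ → Set X) (hS : ∀ k, MeasurableSet (S k))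
    (hSd : Pairwise fun i j => Disjoint (S i) (S j)) (hSu : ⋃ k, S k = Set.univ)
    (hfin : ∀ k, Λ (S k) ≠ ∞)
    (hbdd : ∀ B : Set X, Bornology.IsBounded B → ∃ K, ∀ k ≥ K, Disjoint B (S k)) :
    ∃ (Ω₀ : Type) (_ : MeasurableSpace Ω₀) (P₀ : Measure Ω₀) (_ : IsProbabilityMeasure P₀)
      (M : Ω₀ → Measure X), IsPoissonPointProcess P₀ Λ M := by
  have hex (k : ℕ) : ∃ π : Measure X, IsProbabilityMeasure π ∧
      ((Λ (S k)).toNNReal : ℝ≥0∞) • π = Λ.restrict (S k) := by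
    have : IsFiniteMeasure (Λ.restrict (S k)) := ⟨by simpa using (hfin k).lt_top⟩
    obtain ⟨π, hπ, h⟩ := exists_isProbabilityMeasure_smul_eq (Λ.restrict (S k))
    refine ⟨π, hπ, ?_⟩
    rw [ENNReal.coe_toNNReal (hfin k)]
    simpa using h
  choose π hπ hΛ using hex
  set r : ℕ → ℝ≥0 := fun k => (Λ (S k)).toNNReal
  have hmono (B : Set X) (ω : ℕ → ℕ × (ℕ → X)) :
      Monotone fun K => (partialCount S K B ω : ℝ≥0∞) := by
    intro K L hKL
    simp only [Nat.cast_le]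
    exact Finset.sum_le_sum_of_subset (Finset.range_mono hKL)
  have hmeas (K : ℕ) {B : Set X} (hB : MeasurableSet B) :
      Measurable fun ω => (partialCount S K B ω : ℝ≥0∞) := by
    have := measurable_partialCount hS K hB
    fun_prop
  refine ⟨ℕ → ℕ × (ℕ → X), inferInstance, Measure.infinitePi fun k => pieceLaw (r k) (π k),
    inferInstance, pointProcess S, ?_, ?_, ?_, ?_⟩
  · refine Measure.measurable_of_measurable_coe _ fun B hB => ?_
    simp_rw [pointProcess_apply hS hB]
    exact Measurable.iSup fun K => hmeas K hB
  · intro ω B hB hb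
    obtain ⟨K, hK⟩ := hbdd B hb
    -- A bounded set misses all pieces from the `K`-th on, so its count is already attained by the
    -- first `K` pieces.
    refine ⟨partialCount S K B ω, ?_⟩
    rw [pointProcess_apply hS hB]
    refine le_antisymm (iSup_le fun L => ?_) (le_iSup (fun K => (partialCount S K B ω : ℝ≥0∞)) K)
    rcases le_total L K with hL | hL
    · exact hmono B ω hL
    · rw [Nat.cast_le, partialCount, partialCount, ← Finset.sum_subset (Finset.range_mono hL)]
      intro k _ hk
      have : B ∩ S k = ∅ := (hK k (by simpa using hk)).inter_eq
      simp [pieceSum, this]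
  · intro B hB hΛB
    have hms : Measurable fun ω => pointProcess S ω B := by
      simp_rw [pointProcess_apply hS hB]
      exact Measurable.iSup fun K => hmeas K hB
    refine ⟨hms.aemeasurable, ?_⟩
    have : IsProbabilityMeasure ((Measure.infinitePi fun k => pieceLaw (r k) (π k)).map
      fun ω => pointProcess S ω B) := Measure.isProbabilityMeasure_map hms.aemeasurable
    have : IsProbabilityMeasure ((poissonMeasure (Λ B).toNNReal).map fun k : ℕ => (k : ℝ≥0∞)) :=
      Measure.isProbabilityMeasure_map (by fun_prop)
    -- The partial counts are Poisson with means increasing to `Λ B`. Their distribution functions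
    -- at `a` converge on one side to that of the supremum and on the other to that of the Poisson
    -- law of mean `Λ B`. For `a = ∞` both sides are total masses.
    refine Measure.ext_of_Iic _ _ fun a => ?_
    rcases eq_or_ne a ∞ with rfl | ha
    · simp [Set.Iic_top]
    rw [Measure.map_apply hms measurableSet_Iic, Measure.map_apply (by fun_prop) measurableSet_Iic]
    have hF : (Set.Iic ⌊a.toReal⌋₊ : Set ℕ) = (fun k : ℕ => (k : ℝ≥0∞)) ⁻¹' Set.Iic a := by
      ext k
      rw [Set.mem_preimage, Set.mem_Iic, Set.mem_Iic, Nat.le_floor_iff ENNReal.toReal_nonneg,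
        ← ENNReal.toReal_natCast, ENNReal.toReal_le_toReal (by simp) ha]
    have hr : Tendsto (fun K => (∑ k ∈ Finset.range K, Λ.real (B ∩ S k)).toNNReal) atTop
        (𝓝 (Λ B).toNNReal) := by
      have hfinB (k : ℕ) : Λ (B ∩ S k) ≠ ∞ := measure_ne_top_of_subset Set.inter_subset_left hΛB
      have h1 : Λ B = ∑' k, Λ (B ∩ S k) := by
        rw [← measure_iUnion (fun i j hij => (hSd hij).mono Set.inter_subset_right
          Set.inter_subset_right) (fun k => hB.inter (hS k)), ← Set.inter_iUnion, hSu,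
          Set.inter_univ]
      have h2 : Tendsto (fun K => ∑ k ∈ Finset.range K, Λ (B ∩ S k)) atTop (𝓝 (Λ B)) := by
        rw [h1]
        exact ENNReal.tendsto_nat_tsum _
      refine ((ENNReal.tendsto_toNNReal hΛB).comp h2).congr fun K => ?_
      simp only [Function.comp_apply, Measure.real]
      rw [← ENNReal.toReal_sum fun k _ => hfinB k, ENNReal.toReal, Real.toNNReal_coe]
    have hlim1 := tendsto_poissonMeasure_finset hr (Finset.Iic ⌊a.toReal⌋₊)
    rw [Finset.coe_Iic, hF] at hlim1
    have hlim2 : Tendsto (fun K => (Measure.infinitePi fun k => pieceLaw (r k) (π k))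
        {ω | (partialCount S K B ω : ℝ≥0∞) ≤ a}) atTop
        (𝓝 ((Measure.infinitePi fun k => pieceLaw (r k) (π k))
          ((fun ω => pointProcess S ω B) ⁻¹' Set.Iic a))) := by
      have heq : (fun ω => pointProcess S ω B) ⁻¹' Set.Iic a =
          ⋂ K, {ω | (partialCount S K B ω : ℝ≥0∞) ≤ a} := by
        ext ω
        simp [pointProcess_apply hS hB]
      rw [heq]
      refine tendsto_measure_iInter_atTop (fun K => ?_) ?_ ⟨0, measure_ne_top _ _⟩
      · exact (measurableSet_le (hmeas K hB) measurable_const).nullMeasurableSet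
      · exact fun K L hKL ω hω => (hmono B ω hKL).trans hω
    refine tendsto_nhds_unique hlim2 (hlim1.congr fun K => ?_)
    rw [(hasLaw_partialCount hS hΛ hB K).measure_eq (p := fun z => z ≤ a) measurableSet_Iic,
      Measure.map_apply (by fun_prop) (s := {z | z ≤ a}) measurableSet_Iic]
    rfl
  · intro m B hB hd
    simp_rw [pointProcess_apply hS (hB _)]
    refine iIndepFun_iSup (fun K i => hmeas K (hB i)) (fun i ω => hmono (B i) ω) fun K => ?_
    have h := (iIndepFun_partialCount hS hΛ hB hd K).comp (fun _ => ENNReal.ofReal)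
      (fun _ => ENNReal.measurable_ofReal)
    simpa [Function.comp_def] using h

/-! ### Surface measure in the gnomonic chart. -/

section Gnomonic

variable {E : Type*} [NormedAddCommGroup E] [InnerProductSpace ℝ E]

lemma inner_tangent_eq_zero (q : sphere (0 : E) 1) (v : (ℝ ∙ (q : E))ᗮ) : ⟪(q : E), (v : E)⟫ = 0 :=
  Submodule.mem_orthogonal_singleton_iff_inner_right.1 v.2

lemma inner_sphere_self (q : sphere (0 : E) 1) : ⟪(q : E), (q : E)⟫ = 1 := by
  simp

lemma norm_add_tangent_sq (q : sphere (0 : E) 1) (v : (ℝ ∙ (q : E))ᗮ) :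
    ‖(q : E) + v‖ ^ 2 = 1 + ‖v‖ ^ 2 := by
  have h := norm_add_sq_eq_norm_sq_add_norm_sq_of_inner_eq_zero (q : E) v
    (inner_tangent_eq_zero q v)
  simp only [norm_eq_of_mem_sphere, mul_one, Submodule.coe_norm] at h ⊢
  nlinarith

lemma one_le_norm_add_tangent (q : sphere (0 : E) 1) (v : (ℝ ∙ (q : E))ᗮ) : 1 ≤ ‖(q : E) + v‖ := by
  nlinarith [norm_add_tangent_sq q v, norm_nonneg ((q : E) + v), sq_nonneg ‖v‖]

lemma norm_add_tangent_pos (q : sphere (0 : E) 1) (v : (ℝ ∙ (q : E))ᗮ) : 0 < ‖(q : E) + v‖ :=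
  one_pos.trans_le (one_le_norm_add_tangent q v)

/-- The inverse of the gnomonic projection of the hemisphere around `q` to the tangent space. -/
def gnomonic (q : sphere (0 : E) 1) (v : (ℝ ∙ (q : E))ᗮ) : sphere (0 : E) 1 :=
  ⟨‖(q : E) + v‖⁻¹ • ((q : E) + v), by
    rw [mem_sphere_zero_iff_norm, norm_smul, norm_inv, norm_norm,
      inv_mul_cancel₀ (norm_add_tangent_pos q v).ne']⟩

lemma continuous_gnomonic (q : sphere (0 : E) 1) : Continuous (gnomonic q) := by
  refine Continuous.subtype_mk ?_ _
  have h : Continuous fun v : (ℝ ∙ (q : E))ᗮ => (q : E) + v := by fun_prop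
  exact (h.norm.inv₀ fun v => (norm_add_tangent_pos q v).ne').smul h

@[simp]
lemma gnomonic_zero (q : sphere (0 : E) 1) : gnomonic q 0 = q := by
  ext; simp [gnomonic]

lemma inner_gnomonic (q : sphere (0 : E) 1) (v : (ℝ ∙ (q : E))ᗮ) :
    ⟪(q : E), (gnomonic q v : E)⟫ = ‖(q : E) + v‖⁻¹ := by
  simp [gnomonic, inner_smul_right, inner_add_right, inner_tangent_eq_zero]

variable [FiniteDimensional ℝ E] [MeasurableSpace E] [BorelSpace E]

/-- The orthogonal splitting into the line of `q` and its complement is isometric, so Lebesgue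
measure is the product measure. -/
lemma measurePreserving_smul_add_tangent (q : sphere (0 : E) 1) :
    MeasurePreserving (fun p : ℝ × (ℝ ∙ (q : E))ᗮ => p.1 • (q : E) + (p.2 : E))
      ((volume : Measure ℝ).prod volume) volume := by
  have h1 := (LinearIsometryEquiv.toSpanUnitSingleton (𝕜 := ℝ) (q : E) (by simp)).measurePreserving
  have h2 := h1.prod (MeasurePreserving.id (volume : Measure (ℝ ∙ (q : E))ᗮ))
  have h3 := (WithLp.volume_preserving_toLp (ℝ ∙ (q : E)) ((ℝ ∙ (q : E))ᗮ :)).comp h2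
  have h4 := (ℝ ∙ (q : E)).orthogonalDecomposition.symm.measurePreserving.comp h3
  have h5 : (fun p : ℝ × (ℝ ∙ (q : E))ᗮ => p.1 • (q : E) + (p.2 : E)) =
      (ℝ ∙ (q : E)).orthogonalDecomposition.symm ∘ WithLp.toLp 2 ∘
        Prod.map (LinearIsometryEquiv.toSpanUnitSingleton (𝕜 := ℝ) (q : E) (by simp)) id := by
    funext p
    simp
  rw [h5]
  exact h4

/-- Polar coordinates for the extension of `f` that is constant along rays: the radial integral `∫₀¹
r^{d-1} dr = 1/d` accounts for the factor `finrank`. -/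
lemma lintegral_toSphere [Nontrivial E] {f : E → ℝ≥0∞} (hf : Measurable f) :
    ∫⁻ x : sphere (0 : E) 1, f x ∂(volume : Measure E).toSphere =
      Module.finrank ℝ E * ∫⁻ x in ball (0 : E) 1, f (‖x‖⁻¹ • x) := by
  have hd : 0 < Module.finrank ℝ E := Module.finrank_pos
  have hF : Measurable ((ball (0 : E) 1).indicator fun x => f (‖x‖⁻¹ • x)) :=
    (by fun_prop : Measurable fun x : E => f (‖x‖⁻¹ • x)).indicator measurableSet_ball
  have h1 : ∫⁻ x in ball (0 : E) 1, f (‖x‖⁻¹ • x) =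
      ∫⁻ p : sphere (0 : E) 1 × Set.Ioi (0 : ℝ), f p.1 *
        (Set.Iio (⟨1, Set.mem_Ioi.2 one_pos⟩ : Set.Ioi (0 : ℝ))).indicator 1 p.2
        ∂((volume : Measure E).toSphere.prod (Measure.volumeIoiPow (Module.finrank ℝ E - 1))) := by
    have h0 : ∫⁻ x : E, (ball (0 : E) 1).indicator (fun x => f (‖x‖⁻¹ • x)) x =
        ∫⁻ x in {(0 : E)}ᶜ, (ball (0 : E) 1).indicator (fun x => f (‖x‖⁻¹ • x)) x := by
      rw [restrict_compl_singleton]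
    rw [← lintegral_indicator measurableSet_ball, h0,
      ← lintegral_subtype_comap (measurableSet_singleton _).compl,
      ← (volume : Measure E).measurePreserving_homeomorphUnitSphereProd.lintegral_comp_emb
        (Homeomorph.measurableEmbedding _)]
    refine lintegral_congr fun x => ?_
    have hx : (homeomorphUnitSphereProd E x).2 < ⟨1, Set.mem_Ioi.2 one_pos⟩ ↔ ‖(x : E)‖ < 1 := by
      rw [← Subtype.coe_lt_coe, homeomorphUnitSphereProd_apply_snd_coe]
    by_cases h : ‖(x : E)‖ < 1
    · simp [h, hx]
    · simp [h, hx]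
  rw [h1, lintegral_prod_mul (f := fun x : sphere (0 : E) 1 => f x)
    (hf.comp measurable_subtype_coe).aemeasurable
    ((measurable_one.indicator measurableSet_Iio).aemeasurable),
    lintegral_indicator_one measurableSet_Iio, Measure.volumeIoiPow_apply_Iio,
    mul_comm _ (ENNReal.ofReal _),
    ← mul_assoc, ← ENNReal.ofReal_natCast, ← ENNReal.ofReal_mul (by positivity)]
  have : ((Module.finrank ℝ E - 1 : ℕ) : ℝ) + 1 = Module.finrank ℝ E := by
    rw [Nat.cast_pred hd]; ring
  rw [this, one_pow, mul_one_div_cancel (by positivity), ENNReal.ofReal_one, one_mul]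

lemma lintegral_Ioo_zero_pow (n : ℕ) {a : ℝ} (ha : 0 < a) :
    ∫⁻ s in Set.Ioo 0 a, ENNReal.ofReal (s ^ n) = ENNReal.ofReal (a ^ (n + 1) / (n + 1)) := by
  rw [Measure.restrict_congr_set Ioo_ae_eq_Ioc,
    ← ofReal_integral_eq_lintegral_ofReal (intervalIntegral.intervalIntegrable_pow _).1,
    ← intervalIntegral.integral_of_le ha.le]
  · simp
  · filter_upwards [ae_restrict_mem measurableSet_Ioc] with y hy
    exact pow_nonneg hy.1.le _

lemma lintegral_comp_smul_pos {F : Type*} [NormedAddCommGroup F] [NormedSpace ℝ F]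
    [FiniteDimensional ℝ F] [MeasurableSpace F] [BorelSpace F] (μ : Measure F) [μ.IsAddHaarMeasure]
    {f : F → ℝ≥0∞} (hf : Measurable f) {s : ℝ} (hs : 0 < s) :
    ∫⁻ w, f w ∂μ = ENNReal.ofReal (s ^ Module.finrank ℝ F) * ∫⁻ v, f (s • v) ∂μ := by
  rw [← lintegral_map hf (measurable_const_smul s), Measure.map_addHaar_smul μ hs.ne',
    lintegral_smul_measure, smul_eq_mul, ← mul_assoc, ← ENNReal.ofReal_mul (by positivity),
    abs_of_pos (by positivity), mul_inv_cancel₀ (by positivity), ENNReal.ofReal_one, one_mul]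

/-- The integral over the unit ball of the extension constant along rays is written in the
coordinates `s (q + v)`, whose Jacobian is `s ^ n`. Along the ray of `v` the ball is `0 < s < ‖q +
v‖⁻¹`, and integrating `s ^ n` gives `‖q + v‖^{-(n+1)} / (n + 1)`; the denominator cancels the
dimension factor of `lintegral_toSphere`. -/
lemma lintegral_hemisphere (q : sphere (0 : E) 1) {n : ℕ} (hn : Module.finrank ℝ E = n + 1)
    (hT : Module.finrank ℝ (ℝ ∙ (q : E))ᗮ = n) {f : E → ℝ≥0∞} (hf : Measurable f)
    (hf0 : ∀ x, ⟪(q : E), x⟫ ≤ 0 → f x = 0) :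
    ∫⁻ x : sphere (0 : E) 1, f x ∂(volume : Measure E).toSphere =
      ∫⁻ v : (ℝ ∙ (q : E))ᗮ, ENNReal.ofReal ((‖(q : E) + v‖⁻¹) ^ (n + 1)) * f (gnomonic q v) := by
  have : Nontrivial E := Module.nontrivial_of_finrank_pos (R := ℝ) (by omega)
  have hG : Measurable ((ball (0 : E) 1).indicator fun x => f (‖x‖⁻¹ • x)) :=
    (by fun_prop : Measurable fun x : E => f (‖x‖⁻¹ • x)).indicator measurableSet_ball
  have hslice (s : ℝ) : ∫⁻ w : (ℝ ∙ (q : E))ᗮ, (ball (0 : E) 1).indicator (fun x => f (‖x‖⁻¹ • x))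
      (s • (q : E) + w) = ∫⁻ v : (ℝ ∙ (q : E))ᗮ,
        (Set.Ioo 0 (‖(q : E) + v‖⁻¹)).indicator (fun s => ENNReal.ofReal (s ^ n)) s *
          f (gnomonic q v) := by
    rcases le_or_gt s 0 with hs | hs
    · have h1 (w : (ℝ ∙ (q : E))ᗮ) : (ball (0 : E) 1).indicator (fun x => f (‖x‖⁻¹ • x))
          (s • (q : E) + w) = 0 := by
        refine Set.indicator_apply_eq_zero.2 fun _ => hf0 _ ?_
        rw [inner_smul_right, inner_add_right, inner_smul_right, inner_tangent_eq_zero,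
          inner_sphere_self]
        exact mul_nonpos_of_nonneg_of_nonpos (by positivity) (by linarith)
      simp [h1, hs.not_gt]
    · rw [lintegral_comp_smul_pos volume (f := fun w : (ℝ ∙ (q : E))ᗮ => (ball (0 : E) 1).indicator
        (fun x => f (‖x‖⁻¹ • x)) (s • (q : E) + w)) (hG.comp (by fun_prop :
        Measurable fun w : (ℝ ∙ (q : E))ᗮ => s • (q : E) + (w : E))) hs, hT,
        ← lintegral_const_mul' _ _ (by simp)]
      refine lintegral_congr fun v => ?_
      have hN := norm_add_tangent_pos q v
      have h1 : s • (q : E) + ((s • v : (ℝ ∙ (q : E))ᗮ) : E) = s • ((q : E) + v) := by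
        simp [smul_add]
      simp only [h1]
      have h2 : ‖s • ((q : E) + v)‖ = s * ‖(q : E) + v‖ := by
        rw [norm_smul, Real.norm_of_nonneg hs.le]
      by_cases hlt : s * ‖(q : E) + v‖ < 1
      · have h3 : s < ‖(q : E) + v‖⁻¹ :=
            by rwa [lt_inv_comm₀ hs hN, ← one_div, lt_div_iff₀ hs, mul_comm]
        rw [Set.indicator_of_mem (mem_ball_zero_iff.2 (h2.trans_lt hlt)),
          Set.indicator_of_mem (show s ∈ Set.Ioo 0 _ from ⟨hs, h3⟩), h2,
          smul_smul]
        congr 2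
        simp only [gnomonic]
        congr 1
        field_simp
      · have h3 : ¬ s < ‖(q : E) + v‖⁻¹ :=
            by rwa [lt_inv_comm₀ hs hN, ← one_div, lt_div_iff₀ hs, mul_comm]
        rw [Set.indicator_of_notMem fun h => hlt (h2 ▸ mem_ball_zero_iff.1 h),
          Set.indicator_of_notMem
          (fun h => h3 h.2)]
        simp
  have hmeas : Measurable fun p : ℝ × (ℝ ∙ (q : E))ᗮ =>
      (Set.Ioo 0 (‖(q : E) + p.2‖⁻¹)).indicator (fun s => ENNReal.ofReal (s ^ n)) p.1 *
          f (gnomonic q p.2) := by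
    refine Measurable.mul ?_ (hf.comp (measurable_subtype_coe.comp
      ((continuous_gnomonic q).measurable.comp measurable_snd)))
    have : (fun p : ℝ × (ℝ ∙ (q : E))ᗮ => (Set.Ioo 0 (‖(q : E) + p.2‖⁻¹)).indicator
        (fun s => ENNReal.ofReal (s ^ n)) p.1) =
        {p : ℝ × (ℝ ∙ (q : E))ᗮ | 0 < p.1 ∧ p.1 < ‖(q : E) + p.2‖⁻¹}.indicator
          (fun p => ENNReal.ofReal (p.1 ^ n)) := by
      ext p
      simp [Set.indicator_apply]
    rw [this]
    refine (by fun_prop : Measurable fun p : ℝ × (ℝ ∙ (q : E))ᗮ =>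
      ENNReal.ofReal (p.1 ^ n)).indicator ?_
    exact (measurableSet_lt measurable_const measurable_fst).inter
      (measurableSet_lt measurable_fst (by fun_prop))
  rw [lintegral_toSphere hf, ← lintegral_indicator measurableSet_ball,
    ← (measurePreserving_smul_add_tangent q).lintegral_comp hG,
    lintegral_prod (fun p : ℝ × (ℝ ∙ (q : E))ᗮ => (ball (0 : E) 1).indicator
      (fun x => f (‖x‖⁻¹ • x)) (p.1 • (q : E) + p.2))
      (hG.comp (measurePreserving_smul_add_tangent q).measurable).aemeasurable]
  simp_rw [hslice]
  rw [lintegral_lintegral_swap hmeas.aemeasurable, ← lintegral_const_mul' _ _ (by simp)]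
  refine lintegral_congr fun v => ?_
  have hN := norm_add_tangent_pos q v
  rw [lintegral_mul_const _ ((by fun_prop :
    Measurable fun s : ℝ => ENNReal.ofReal (s ^ n)).indicator
      measurableSet_Ioo),
    lintegral_indicator measurableSet_Ioo, lintegral_Ioo_zero_pow n (by positivity), ← mul_assoc,
    hn, ← ENNReal.ofReal_natCast, ← ENNReal.ofReal_mul (by positivity)]
  congr 2
  push_cast
  field_simp

/-- In the gnomonic chart the surface measure has density `‖q + v‖ ^ (-d)`. -/
lemma toSphere_restrict_hemisphere (q : sphere (0 : E) 1) {n : ℕ}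
    (hn : Module.finrank ℝ E = n + 1) (hT : Module.finrank ℝ (ℝ ∙ (q : E))ᗮ = n) :
    (volume : Measure E).toSphere.restrict {x | 0 < ⟪(q : E), (x : E)⟫} =
      ((volume : Measure (ℝ ∙ (q : E))ᗮ).withDensity
        fun v => ENNReal.ofReal ((‖(q : E) + v‖⁻¹) ^ (n + 1))).map (gnomonic q) := by
  have hH : MeasurableSet {x : sphere (0 : E) 1 | 0 < ⟪(q : E), (x : E)⟫} :=
    measurableSet_lt measurable_const (by fun_prop)
  have hgn := (continuous_gnomonic q).measurable
  ext s hs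
  have hemb : MeasurableEmbedding ((↑) : sphere (0 : E) 1 → E) :=
    MeasurableEmbedding.subtype_coe isClosed_sphere.measurableSet
  -- `lintegral_hemisphere` takes functions on the ambient space, so the set is tested through its
  -- image there.
  have hA : MeasurableSet ((↑) '' (s ∩ {x : sphere (0 : E) 1 | 0 < ⟪(q : E), (x : E)⟫}) : Set E) :=
    hemb.measurableSet_image.2 (hs.inter hH)
  have h := lintegral_hemisphere q hn hT (measurable_one.indicator hA) (fun x hx => by
    refine Set.indicator_of_notMem ?_ _
    rintro ⟨y, ⟨-, hy⟩, rfl⟩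
    exact absurd hx (not_le.2 hy))
  have h1 (x : sphere (0 : E) 1) : ((↑) '' (s ∩ {x : sphere (0 : E) 1 | 0 < ⟪(q : E), (x : E)⟫}) :
      Set E).indicator (1 : E → ℝ≥0∞) x =
      (s ∩ {x : sphere (0 : E) 1 | 0 < ⟪(q : E), (x : E)⟫}).indicator 1 x := by
    by_cases hx : x ∈ s ∩ {x : sphere (0 : E) 1 | 0 < ⟪(q : E), (x : E)⟫}
    · rw [Set.indicator_of_mem hx, Set.indicator_of_mem (Set.mem_image_of_mem _ hx)]
      rfl
    · rw [Set.indicator_of_notMem hx, Set.indicator_of_notMem]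
      rwa [Function.Injective.mem_set_image Subtype.val_injective]
  simp_rw [h1] at h
  rw [lintegral_indicator_one (hs.inter hH)] at h
  rw [Measure.restrict_apply hs, h, Measure.map_apply hgn hs, withDensity_apply _ (hgn hs),
    ← lintegral_indicator (hgn hs)]
  refine lintegral_congr fun v => ?_
  have hpos : 0 < ⟪(q : E), (gnomonic q v : E)⟫ := by
    rw [inner_gnomonic]
    exact inv_pos.2 (norm_add_tangent_pos q v)
  by_cases hv : gnomonic q v ∈ s
  · rw [Set.indicator_of_mem (show gnomonic q v ∈ s ∩ _ from ⟨hv, hpos⟩),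
      Set.indicator_of_mem (show v ∈ gnomonic q ⁻¹' s from hv)]
    simp
  · rw [Set.indicator_of_notMem (fun h => hv h.1),
      Set.indicator_of_notMem (show v ∉ gnomonic q ⁻¹' s from hv)]
    simp

end Gnomonic

/-! ### Laplace-type localization at `q`. -/

section Localization

variable {E : Type*} [NormedAddCommGroup E] [InnerProductSpace ℝ E]

/-- With `N = ‖q + v‖` one has `‖v‖² = (N - 1)(N + 1)` and `1 - N⁻¹ = (N - 1) / N`, so the claim
reduces to `N (N + 1) ≤ 6`, true for `N ≤ 2`. It turns exponential decay in the distance-to-query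
into Gaussian decay in the chart. -/
lemma norm_sq_le_of_norm_add_tangent_lt_two (q : sphere (0 : E) 1) (v : (ℝ ∙ (q : E))ᗮ)
    (h : ‖(q : E) + v‖ < 2) : ‖v‖ ^ 2 / 6 ≤ 1 - ‖(q : E) + v‖⁻¹ := by
  have h1 := one_le_norm_add_tangent q v
  have h2 := norm_add_tangent_sq q v
  set N := ‖(q : E) + v‖
  have hN : 0 < N := by linarith
  have h3 : ‖v‖ ^ 2 = N ^ 2 - 1 := by linarith
  rw [h3, ← one_div, le_sub_iff_add_le, div_add_div _ _ (by norm_num) hN.ne',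
    div_le_one (by positivity)]
  nlinarith [mul_nonneg (sub_nonneg.2 h1) (by nlinarith : 0 ≤ 6 - N * (N + 1))]

variable [FiniteDimensional ℝ E] [MeasurableSpace E] [BorelSpace E]

lemma integrable_exp_neg_mul_norm_sq {V : Type*} [NormedAddCommGroup V] [InnerProductSpace ℝ V]
    [FiniteDimensional ℝ V] [MeasurableSpace V] [BorelSpace V] {b : ℝ} (hb : 0 < b) :
    Integrable (fun v : V => Real.exp (-b * ‖v‖ ^ 2)) := by
  have h := (GaussianFourier.integrable_cexp_neg_mul_sq_norm_add (V := V) (b := (b : ℂ))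
    (by simpa using hb) 0 0).norm
  refine h.congr (ae_of_all _ fun v => ?_)
  simp only [Complex.norm_exp]
  congr 1
  simp [← Complex.ofReal_pow]

lemma integral_hemisphere (q : sphere (0 : E) 1) {n : ℕ} (hn : Module.finrank ℝ E = n + 1)
    (hT : Module.finrank ℝ (ℝ ∙ (q : E))ᗮ = n) {F : Type*} [NormedAddCommGroup F]
    [NormedSpace ℝ F] {f : sphere (0 : E) 1 → F} (hf : StronglyMeasurable f)
    (hf0 : ∀ x : sphere (0 : E) 1, ⟪(q : E), (x : E)⟫ ≤ 0 → f x = 0) :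
    ∫ x, f x ∂(volume : Measure E).toSphere =
      ∫ v : (ℝ ∙ (q : E))ᗮ, (‖(q : E) + v‖⁻¹ ^ (n + 1)) • f (gnomonic q v) := by
  have hH : MeasurableSet {x : sphere (0 : E) 1 | 0 < ⟪(q : E), (x : E)⟫} :=
    measurableSet_lt measurable_const (by fun_prop)
  have h1 : ∫ x, f x ∂(volume : Measure E).toSphere =
      ∫ x in {x | 0 < ⟪(q : E), (x : E)⟫}, f x ∂(volume : Measure E).toSphere := by
    rw [← integral_indicator hH]
    congr 1 with x
    by_cases hx : x ∈ {x : sphere (0 : E) 1 | 0 < ⟪(q : E), (x : E)⟫}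
    · rw [Set.indicator_of_mem hx]
    · rw [Set.indicator_of_notMem hx, hf0 x (not_lt.1 hx)]
  rw [h1, toSphere_restrict_hemisphere q hn hT, integral_map
    (continuous_gnomonic q).measurable.aemeasurable hf.aestronglyMeasurable]
  simp only [ENNReal.ofReal]
  rw [integral_withDensity_eq_integral_smul (by fun_prop)]
  refine integral_congr_ae (ae_of_all _ fun v => ?_)
  simp only [NNReal.smul_def]
  rw [Real.coe_toNNReal _ (by positivity)]

lemma pow_mul_integral_comp_inv_smul {V F : Type*} [NormedAddCommGroup V] [NormedSpace ℝ V]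
    [FiniteDimensional ℝ V] [MeasurableSpace V] [BorelSpace V] (μ : Measure V)
    [μ.IsAddHaarMeasure] [NormedAddCommGroup F] [NormedSpace ℝ F] (f : V → F) {s : ℝ}
    (hs : 0 < s) :
    s ^ Module.finrank ℝ V • ∫ v, f v ∂μ = ∫ w, f (s⁻¹ • w) ∂μ := by
  rw [Measure.integral_comp_smul, inv_pow, inv_inv, abs_of_pos (by positivity)]

/-- Laplace-type localization of integrals over the sphere: if the integrands `g i` concentrate near
`q` at scale `β i ^ (-1/2)`, then their rescaled integrals against a continuous density converge
to an integral over the tangent space. -/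
theorem tendsto_integral_sphere_localization (q : sphere (0 : E) 1) {n : ℕ}
    (hn : Module.finrank ℝ E = n + 1) (hT : Module.finrank ℝ (ℝ ∙ (q : E))ᗮ = n)
    {F : Type*} [NormedAddCommGroup F] [NormedSpace ℝ F]
    {ρ : sphere (0 : E) 1 → ℝ} (hρ : Continuous ρ) {ι : Type*} {l : Filter ι}
    [l.IsCountablyGenerated] {β : ι → ℝ} (hβ : Tendsto β l atTop)
    {g : ι → sphere (0 : E) 1 → F} (hg : ∀ i, StronglyMeasurable (g i)) {C c : ℝ} (hc : 0 < c)
    (hbound : ∀ᶠ i in l, ∀ x, ‖g i x‖ ≤ C * Real.exp (-c * (β i * (1 - ⟪(q : E), (x : E)⟫))))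
    {G : (ℝ ∙ (q : E))ᗮ → F}
    (hlim : ∀ᵐ v, Tendsto (fun i => g i (gnomonic q ((√(β i))⁻¹ • v))) l (𝓝 (G v))) :
    Tendsto (fun i => (√(β i)) ^ n • ∫ x, ρ x • g i x ∂(volume : Measure E).toSphere) l
      (𝓝 (ρ q • ∫ v, G v)) := by
  rcases l.eq_or_neBot with rfl | hne
  · simp
  obtain ⟨R, hR⟩ := (isCompact_range hρ).isBounded.exists_norm_le
  replace hR (x : sphere (0 : E) 1) : ‖ρ x‖ ≤ R := hR _ ⟨x, rfl⟩
  have hR0 : 0 ≤ R := (norm_nonneg _).trans (hR q)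
  have hC0 : 0 ≤ C := by
    obtain ⟨i, hi⟩ := hbound.exists
    have := (norm_nonneg _).trans (hi q)
    rw [inner_sphere_self] at this
    simpa using this
  -- In the chart this cap is `‖q + v‖ < 2`, the range where the quadratic lower bound on the
  -- distance-to-query holds.
  set A : Set (sphere (0 : E) 1) := {x | 1 / 2 < ⟪(q : E), (x : E)⟫} with hA_def
  have hA : MeasurableSet A := measurableSet_lt measurable_const (by fun_prop)
  have hρm : StronglyMeasurable ρ := hρ.stronglyMeasurable
  have hint : ∀ᶠ i in l, Integrable (fun x => ρ x • g i x) (volume : Measure E).toSphere := by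
    filter_upwards [hbound, hβ.eventually_ge_atTop 0] with i hi hi0
    refine Integrable.of_bound (hρm.smul (hg i)).aestronglyMeasurable (C := R * C)
      (ae_of_all _ fun x => ?_)
    rw [norm_smul]
    refine mul_le_mul (hR x) ((hi x).trans ?_) (norm_nonneg _) hR0
    have h1 : ⟪(q : E), (x : E)⟫ ≤ 1 := by
      simpa using real_inner_le_norm (q : E) (x : E)
    have h2 : 0 ≤ β i * (1 - ⟪(q : E), (x : E)⟫) := mul_nonneg hi0 (by linarith)
    refine mul_le_of_le_one_right hC0 (Real.exp_le_one_iff.2 ?_)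
    nlinarith
  have hsqrt : Tendsto (fun i => √(β i)) l atTop := Real.tendsto_sqrt_atTop.comp hβ
  -- the part of the sphere away from `q`
  have hfar : Tendsto (fun i => (√(β i)) ^ n • ∫ x in Aᶜ, ρ x • g i x
      ∂(volume : Measure E).toSphere) l (𝓝 0) := by
    -- Off the cap `1 - ⟪q, x⟫ ≥ 1/2`, so the integrand carries a factor `e^{-cβ/2}`, which beats
    -- the power of `β`.
    have hlim0 : Tendsto (fun i => (√(β i)) ^ n * Real.exp (-(c / 2) * β i) *
        (R * C * (volume : Measure E).toSphere.real Set.univ)) l (𝓝 0) := by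
      have h1 := (tendsto_rpow_mul_exp_neg_mul_atTop_nhds_zero ((n : ℝ) / 2) (c / 2)
        (by positivity)).comp hβ
      have h2 : Tendsto (fun i => (√(β i)) ^ n * Real.exp (-(c / 2) * β i)) l (𝓝 0) := by
        refine h1.congr' ?_
        filter_upwards [hβ.eventually_ge_atTop 0] with i hi
        simp only [Function.comp_apply]
        rw [Real.sqrt_eq_rpow, ← Real.rpow_natCast, ← Real.rpow_mul hi]
        congr 2
        ring
      simpa using h2.mul_const (R * C * (volume : Measure E).toSphere.real Set.univ)
    rw [tendsto_zero_iff_norm_tendsto_zero]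
    refine squeeze_zero' (Eventually.of_forall fun _ => norm_nonneg _) ?_ hlim0
    filter_upwards [hbound, hβ.eventually_ge_atTop 0] with i hi hi0
    rw [norm_smul, Real.norm_of_nonneg (by positivity), mul_assoc]
    refine mul_le_mul_of_nonneg_left ?_ (by positivity)
    have h1 := norm_setIntegral_le_of_norm_le_const (μ := (volume : Measure E).toSphere) (s := Aᶜ)
      (f := fun x => ρ x • g i x) (C := R * (C * Real.exp (-(c / 2) * β i)))
      (measure_lt_top _ _) (fun x hx => by
        rw [norm_smul]
        refine mul_le_mul (hR x) ((hi x).trans ?_) (norm_nonneg _) hR0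
        refine mul_le_mul_of_nonneg_left (Real.exp_le_exp.2 ?_) hC0
        have hx' : ⟪(q : E), (x : E)⟫ ≤ 1 / 2 := not_lt.1 hx
        nlinarith [mul_nonneg hi0 (by linarith : 0 ≤ 1 / 2 - ⟪(q : E), (x : E)⟫),
          mul_nonneg hc.le (mul_nonneg hi0 (by linarith : 0 ≤ 1 / 2 - ⟪(q : E), (x : E)⟫))])
    refine h1.trans ?_
    have h2 : (volume : Measure E).toSphere.real Aᶜ ≤ (volume : Measure E).toSphere.real Set.univ :=
      measureReal_mono (Set.subset_univ _)
    calc R * (C * Real.exp (-(c / 2) * β i)) * (volume : Measure E).toSphere.real Aᶜ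
        ≤ R * (C * Real.exp (-(c / 2) * β i)) * (volume : Measure E).toSphere.real Set.univ := by
          gcongr
      _ = _ := by ring
  -- the cap around `q`, in the rescaled gnomonic chart
  set h : ι → (ℝ ∙ (q : E))ᗮ → F := fun i v => (‖(q : E) + v‖⁻¹ ^ (n + 1)) •
    A.indicator (fun x => ρ x • g i x) (gnomonic q v) with hh
  have hnear_eq : ∀ᶠ i in l, (√(β i)) ^ n • ∫ x in A, ρ x • g i x ∂(volume : Measure E).toSphere =
      ∫ w, h i ((√(β i))⁻¹ • w) := by
    filter_upwards [hβ.eventually_gt_atTop 0] with i hi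
    have h1 := pow_mul_integral_comp_inv_smul (volume : Measure (ℝ ∙ (q : E))ᗮ) (h i)
      (Real.sqrt_pos.2 hi)
    rw [hT] at h1
    rw [← h1, ← integral_indicator hA, integral_hemisphere q hn hT
      (f := A.indicator fun x => ρ x • g i x) ((hρm.smul (hg i)).indicator hA)]
    intro x hx
    refine Set.indicator_of_notMem (fun hxA => ?_) _
    have : 1 / 2 < ⟪(q : E), (x : E)⟫ := hxA
    linarith
  have hnear : Tendsto (fun i => ∫ w, h i ((√(β i))⁻¹ • w)) l (𝓝 (∫ v, ρ q • G v)) := by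
    refine tendsto_integral_filter_of_dominated_convergence
      -- On the cap the exponent satisfies `β (1 - ⟪q, x⟫) ≥ β ‖v‖² / 6 = ‖w‖² / 6`, and the chart
      -- density is at most `1`.
      (fun w => R * C * Real.exp (-(c / 6) * ‖w‖ ^ 2)) ?_ ?_ ?_ ?_
    · refine Eventually.of_forall fun i => ?_
      have hgn := (continuous_gnomonic q).measurable
      have h1 : StronglyMeasurable (h i) := by
        refine StronglyMeasurable.smul (Measurable.stronglyMeasurable (by fun_prop)) ?_
        exact ((hρm.smul (hg i)).indicator hA).comp_measurable hgn
      exact (h1.comp_measurable (measurable_const_smul _)).aestronglyMeasurable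
    · filter_upwards [hbound, hβ.eventually_gt_atTop 0] with i hi hi0
      refine ae_of_all _ fun w => ?_
      have hs := Real.sqrt_pos.2 hi0
      set v := (√(β i))⁻¹ • w with hv
      have hN := norm_add_tangent_pos q v
      simp only [hh]
      by_cases hvA : gnomonic q v ∈ A
      · rw [Set.indicator_of_mem hvA, norm_smul, norm_smul]
        have hlt : ‖(q : E) + v‖ < 2 := by
          have : 1 / 2 < ⟪(q : E), (gnomonic q v : E)⟫ := hvA
          rw [inner_gnomonic, one_div, inv_lt_inv₀ (by norm_num) hN] at this
          exact this
        have hle : ‖‖(q : E) + v‖⁻¹ ^ (n + 1)‖ ≤ 1 := by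
          rw [Real.norm_of_nonneg (by positivity)]
          exact pow_le_one₀ (by positivity) (inv_le_one_of_one_le₀ (one_le_norm_add_tangent q v))
        have hexp : ‖g i (gnomonic q v)‖ ≤ C * Real.exp (-(c / 6) * ‖w‖ ^ 2) := by
          refine (hi _).trans (mul_le_mul_of_nonneg_left (Real.exp_le_exp.2 ?_) hC0)
          rw [inner_gnomonic]
          have h1 := norm_sq_le_of_norm_add_tangent_lt_two q v hlt
          have h2 : ‖w‖ ^ 2 = β i * ‖v‖ ^ 2 := by
            rw [hv, norm_smul, norm_inv, Real.norm_of_nonneg hs.le, mul_pow, inv_pow,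
              Real.sq_sqrt hi0.le]
            field_simp
          rw [h2]
          nlinarith [mul_le_mul_of_nonneg_left h1 (mul_nonneg hc.le hi0.le)]
        calc ‖‖(q : E) + v‖⁻¹ ^ (n + 1)‖ * (‖ρ (gnomonic q v)‖ * ‖g i (gnomonic q v)‖)
            ≤ 1 * (R * (C * Real.exp (-(c / 6) * ‖w‖ ^ 2))) := by
              gcongr
              exact hR _
          _ = _ := by ring
      · rw [Set.indicator_of_notMem hvA, smul_zero, norm_zero]
        positivity
    · exact (integrable_exp_neg_mul_norm_sq (by positivity)).const_mul _
    · filter_upwards [hlim] with w hw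
      have hv : Tendsto (fun i => (√(β i))⁻¹ • w) l (𝓝 0) := by
        simpa using (tendsto_inv_atTop_zero.comp hsqrt).smul_const w
      have hgn : Tendsto (fun i => gnomonic q ((√(β i))⁻¹ • w)) l (𝓝 q) := by
        simpa [Function.comp_def] using ((continuous_gnomonic q).tendsto 0).comp hv
      have h1 : Tendsto (fun i => ‖(q : E) + ((√(β i))⁻¹ • w : (ℝ ∙ (q : E))ᗮ)‖⁻¹ ^ (n + 1)) l
          (𝓝 1) := by
        have h2 : Continuous fun v : (ℝ ∙ (q : E))ᗮ => ‖(q : E) + v‖⁻¹ ^ (n + 1) :=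
          (Continuous.inv₀ (by fun_prop) fun v => (norm_add_tangent_pos q v).ne').pow _
        have := (h2.tendsto 0).comp hv
        simpa [Function.comp_def] using this
      have h3 := h1.smul (((hρ.tendsto q).comp hgn).smul hw)
      rw [one_smul] at h3
      refine h3.congr' ?_
      have hopen : IsOpen A := isOpen_lt continuous_const (by fun_prop)
      have hq : q ∈ A := by
        rw [hA_def, Set.mem_ofPred_eq, inner_sphere_self]
        norm_num
      filter_upwards [hgn.eventually (hopen.mem_nhds hq)] with i hi
      simp only [hh]
      rw [Set.indicator_of_mem (show gnomonic q ((√(β i))⁻¹ • w) ∈ A from hi)]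
      rfl
  rw [integral_smul] at hnear
  have hsum := (hnear.congr' (hnear_eq.mono fun i hi => hi.symm)).add hfar
  rw [add_zero] at hsum
  refine hsum.congr' ?_
  filter_upwards [hint] with i hi
  rw [← smul_add, integral_add_compl hA hi]

end Localization

/-! ### The critical intensity as Lebesgue measure in polar coordinates. -/

section Polar

/-- The map `s ↦ s² / 2` from the open to the closed half-line. -/
def halfSq (s : Set.Ioi (0 : ℝ)) : ℝ≥0 := ⟨(s : ℝ) ^ 2 / 2, by positivity⟩

lemma coe_halfSq (s : Set.Ioi (0 : ℝ)) : (halfSq s : ℝ) = (s : ℝ) ^ 2 / 2 := rfl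

lemma measurable_halfSq : Measurable halfSq :=
  Measurable.subtype_mk (by fun_prop)

lemma setLIntegral_comap_nnreal_Iio (f : ℝ → ℝ≥0∞) (a : ℝ≥0) :
    ∫⁻ y in Set.Iio a, f y ∂((volume : Measure ℝ).comap ((↑) : ℝ≥0 → ℝ)) =
      ∫⁻ y in Set.Ioc 0 (a : ℝ), f y := by
  have hemb : MeasurableEmbedding ((↑) : ℝ≥0 → ℝ) :=
    MeasurableEmbedding.subtype_coe measurableSet_Ici
  have hr : Set.range ((↑) : ℝ≥0 → ℝ) = Set.Ici 0 := by
    ext x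
    exact ⟨fun ⟨y, hy⟩ => hy ▸ y.2, fun hx => ⟨⟨x, hx⟩, rfl⟩⟩
  have h1 : ∫⁻ y in Set.Iio a, f y ∂((volume : Measure ℝ).comap ((↑) : ℝ≥0 → ℝ)) =
      ∫⁻ y : ℝ≥0, (Set.Iio (a : ℝ)).indicator f y
        ∂((volume : Measure ℝ).comap ((↑) : ℝ≥0 → ℝ)) := by
    rw [← lintegral_indicator measurableSet_Iio]
    refine lintegral_congr fun y => ?_
    by_cases h : y < a <;> simp [h]
  rw [h1, ← hemb.lintegral_map, hemb.map_comap, hr, lintegral_indicator measurableSet_Iio,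
    Measure.restrict_restrict measurableSet_Iio, Set.Iio_inter_Ici,
    Measure.restrict_congr_set Ico_ae_eq_Ioc]

/-- Substituting `y = s² / 2` turns `s^{n-1} ds` into `(2y)^{n/2-1} dy`. Equality is checked on the
intervals below `a`, where both sides equal `(2a)^{n/2} / n`. -/
lemma map_halfSq_volumeIoiPow {n : ℕ} (hn : 1 ≤ n) :
    (Measure.volumeIoiPow (n - 1)).map halfSq =
      ((volume : Measure ℝ).comap ((↑) : ℝ≥0 → ℝ)).withDensity fun y => ENNReal.ofReal
        (2 ^ ((n : ℝ) / 2 - 1) * (y : ℝ) ^ ((n : ℝ) / 2 - 1)) := by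
  have hn0 : (0 : ℝ) < n := by exact_mod_cast hn
  have hL (a : ℝ≥0) : (Measure.volumeIoiPow (n - 1)).map halfSq (Set.Iio a) =
      ENNReal.ofReal ((2 * a) ^ ((n : ℝ) / 2) / n) := by
    rw [Measure.map_apply measurable_halfSq measurableSet_Iio]
    rcases eq_or_ne a 0 with rfl | ha
    · simp [Real.zero_rpow (show (n : ℝ) / 2 ≠ 0 by positivity)]
    · have ha' : (0 : ℝ) < a := by positivity
      have hpos : 0 < √(2 * (a : ℝ)) := Real.sqrt_pos.2 (by positivity)
      have hset : halfSq ⁻¹' Set.Iio a = Set.Iio ⟨√(2 * (a : ℝ)), hpos⟩ := by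
        ext s
        have hs : (0 : ℝ) < s := s.2
        rw [Set.mem_preimage, Set.mem_Iio, Set.mem_Iio, ← Subtype.coe_lt_coe, ← NNReal.coe_lt_coe,
          Real.lt_sqrt hs.le]
        rw [coe_halfSq, div_lt_iff₀ two_pos, mul_comm]
      rw [hset, Measure.volumeIoiPow_apply_Iio]
      congr 1
      have h1 : n - 1 + 1 = n := by omega
      have h2 : ((n - 1 : ℕ) : ℝ) + 1 = n := by rw [← Nat.cast_succ, Nat.succ_eq_add_one, h1]
      rw [h1, h2]
      change √(2 * (a : ℝ)) ^ n / (n : ℝ) = _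
      rw [Real.sqrt_eq_rpow, ← Real.rpow_natCast, ← Real.rpow_mul (by positivity)]
      congr 2
      ring
  have hR (a : ℝ≥0) : ((volume : Measure ℝ).comap ((↑) : ℝ≥0 → ℝ)).withDensity (fun y =>
      ENNReal.ofReal (2 ^ ((n : ℝ) / 2 - 1) * (y : ℝ) ^ ((n : ℝ) / 2 - 1))) (Set.Iio a) =
      ENNReal.ofReal ((2 * a) ^ ((n : ℝ) / 2) / n) := by
    rw [withDensity_apply _ measurableSet_Iio, setLIntegral_comap_nnreal_Iio
      (fun y => ENNReal.ofReal (2 ^ ((n : ℝ) / 2 - 1) * y ^ ((n : ℝ) / 2 - 1)))]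
    -- For `n = 1` the density has an integrable singularity `y^{-1/2}` at `0`.
    have hexp : -1 < (n : ℝ) / 2 - 1 := by linarith [half_pos hn0]
    have hint : IntervalIntegrable (fun y : ℝ => 2 ^ ((n : ℝ) / 2 - 1) * y ^ ((n : ℝ) / 2 - 1))
        volume 0 a := (intervalIntegral.intervalIntegrable_rpow' hexp).const_mul _
    rw [← ofReal_integral_eq_lintegral_ofReal hint.1,
      ← intervalIntegral.integral_of_le a.coe_nonneg,
      intervalIntegral.integral_const_mul, integral_rpow (Or.inl hexp)]
    · congr 1
      rw [sub_add_cancel, Real.zero_rpow (by positivity), sub_zero,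
        Real.mul_rpow two_pos.le a.coe_nonneg,
        Real.rpow_sub_one two_ne_zero]
      field_simp
    · filter_upwards [ae_restrict_mem measurableSet_Ioc] with y hy
      have := hy.1.le
      positivity
  refine Measure.ext_of_generateFrom_of_iUnion (Set.range Set.Iio) (fun k : ℕ => Set.Iio (k : ℝ≥0))
    ((BorelSpace.measurable_eq (α := ℝ≥0)).trans (borel_eq_generateFrom_Iio _)) isPiSystem_Iio
    ?_ (fun k => ⟨_, rfl⟩) (fun k => ?_) ?_
  · exact Set.iUnion_eq_univ_iff.2 fun x => exists_nat_gt x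
  · rw [hL]
    exact ENNReal.ofReal_ne_top
  · rintro _ ⟨a, rfl⟩
    rw [hL, hR]

/-- The map sending a nonzero tangent vector `w` to `(‖w‖² / 2, w / ‖w‖)`. -/
def tangentPolar {V : Type*} [NormedAddCommGroup V] [NormedSpace ℝ V] (w : ({0}ᶜ : Set V)) :
    ℝ≥0 × sphere (0 : V) 1 :=
  (halfSq (homeomorphUnitSphereProd V w).2, (homeomorphUnitSphereProd V w).1)

lemma coe_tangentPolar_fst {V : Type*} [NormedAddCommGroup V] [NormedSpace ℝ V]
    (w : ({0}ᶜ : Set V)) : ((tangentPolar w).1 : ℝ) = ‖(w : V)‖ ^ 2 / 2 := by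
  simp [tangentPolar, coe_halfSq]

lemma coe_tangentPolar_snd {V : Type*} [NormedAddCommGroup V] [NormedSpace ℝ V]
    (w : ({0}ᶜ : Set V)) : ((tangentPolar w).2 : V) = ‖(w : V)‖⁻¹ • (w : V) := by
  simp [tangentPolar]

lemma measurable_tangentPolar {V : Type*} [NormedAddCommGroup V] [NormedSpace ℝ V]
    [FiniteDimensional ℝ V] [MeasurableSpace V] [BorelSpace V] :
    Measurable (tangentPolar (V := V)) := by
  have h := (homeomorphUnitSphereProd V).measurable
  exact (measurable_halfSq.comp h.snd).prodMk h.fst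

lemma map_tangentPolar {V : Type*} [NormedAddCommGroup V] [NormedSpace ℝ V]
    [FiniteDimensional ℝ V] [MeasurableSpace V] [BorelSpace V] (μ : Measure V)
    [μ.IsAddHaarMeasure] :
    (μ.comap ((↑) : ({0}ᶜ : Set V) → V)).map tangentPolar =
      ((Measure.volumeIoiPow (Module.finrank ℝ V - 1)).map halfSq).prod μ.toSphere := by
  have h := μ.measurePreserving_homeomorphUnitSphereProd
  have h1 : (tangentPolar (V := V)) = Prod.map halfSq id ∘ Prod.swap ∘
      homeomorphUnitSphereProd V := rfl
  have hm : Measurable (homeomorphUnitSphereProd V) := h.measurable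
  rw [h1, ← Measure.map_map (measurable_halfSq.prodMap measurable_id) (measurable_swap.comp hm),
    ← Measure.map_map measurable_swap hm, h.map_eq, Measure.prod_swap]
  have : SFinite ((Measure.volumeIoiPow (Module.finrank ℝ V - 1)).map halfSq) := inferInstance
  rw [← Measure.map_prod_map _ _ measurable_halfSq measurable_id, Measure.map_id]

lemma finrank_tangentAt {d : ℕ} (hd : 2 ≤ d) (q : USphere d) :
    Module.finrank ℝ (tangentAt q) = d - 1 := by
  have : Fact (Module.finrank ℝ (EuclideanSpace ℝ (Fin d)) = (d - 1) + 1) :=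
    ⟨by rw [finrank_euclideanSpace_fin]; omega⟩
  exact Submodule.finrank_orthogonal_span_singleton (ne_zero_of_mem_unit_sphere q)

/-- Both masses are the dimension times the volume of the unit ball, hence depend only on the
dimension `d - 1`. -/
lemma surfaceMeasure_tangentAt_univ {d : ℕ} (hd : 2 ≤ d) (q : USphere d) :
    surfaceMeasure (tangentAt q) Set.univ =
      surfaceMeasure (EuclideanSpace ℝ (Fin (d - 1))) Set.univ := by
  have hT := finrank_tangentAt hd q
  have hE : Module.finrank ℝ (EuclideanSpace ℝ (Fin (d - 1))) = d - 1 := finrank_euclideanSpace_fin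
  have : Nontrivial (tangentAt q) := Module.nontrivial_of_finrank_pos (R := ℝ) (by omega)
  have : Nontrivial (EuclideanSpace ℝ (Fin (d - 1))) :=
    Module.nontrivial_of_finrank_pos (R := ℝ) (by omega)
  rw [surfaceMeasure, surfaceMeasure, Measure.toSphere_apply_univ, Measure.toSphere_apply_univ,
    InnerProductSpace.volume_ball, InnerProductSpace.volume_ball, hT, hE]

lemma surfaceMeasure_tangentAt_univ_ne_zero {d : ℕ} (hd : 2 ≤ d) (q : USphere d) :
    surfaceMeasure (tangentAt q) Set.univ ≠ 0 := by
  have : Nontrivial (tangentAt q) := Module.nontrivial_of_finrank_pos (R := ℝ) (by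
    rw [finrank_tangentAt hd q]; omega)
  rw [Ne, Measure.measure_univ_eq_zero]
  exact Measure.toSphere_ne_zero _

lemma surfaceMeasure_tangentAt_univ_ne_top {d : ℕ} (q : USphere d) :
    surfaceMeasure (tangentAt q) Set.univ ≠ ∞ := by
  unfold surfaceMeasure
  exact measure_ne_top _ _

lemma one_div_alphaExp {d : ℕ} (hd : 2 ≤ d) : 1 / alphaExp d = ((d - 1 : ℕ) : ℝ) / 2 := by
  rw [alphaExp, Nat.cast_sub (by omega)]
  simp

lemma alphaExp_pos {d : ℕ} (hd : 2 ≤ d) : 0 < alphaExp d := by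
  have : (2 : ℝ) ≤ d := by exact_mod_cast hd
  exact div_pos two_pos (by linarith)

/-- The critical intensity is the image of a multiple of Lebesgue measure on the tangent space. -/
lemma criticalIntensity_eq {d : ℕ} (hd : 2 ≤ d) (q : USphere d) {γ r : ℝ} (hγ : 0 < γ)
    (hr : 0 ≤ r) :
    criticalIntensity q γ r = ENNReal.ofReal (γ ^ (-(1 / alphaExp d)) * r) •
      ((volume : Measure (tangentAt q)).comap ((↑) : ({0}ᶜ : Set (tangentAt q)) → _)).map
        tangentPolar := by
  set σ := (surfaceMeasure (EuclideanSpace ℝ (Fin (d - 1)))).real Set.univ with hσ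
  have hT := finrank_tangentAt hd q
  have h0 := surfaceMeasure_tangentAt_univ_ne_zero hd q
  have htop := surfaceMeasure_tangentAt_univ_ne_top q
  have hσT : surfaceMeasure (tangentAt q) Set.univ = ENNReal.ofReal σ := by
    rw [hσ, Measure.real, ← surfaceMeasure_tangentAt_univ hd q, ENNReal.ofReal_toReal htop]
  have hd1 : (0 : ℝ) < (d : ℝ) - 1 := by
    have : (2 : ℝ) ≤ d := by exact_mod_cast hd
    linarith
  have hσ0 : 0 ≤ σ := measureReal_nonneg
  -- The constants match because `α (d - 1) = 2`. The factor `σ` is split off to cancel the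
  -- normalization of the uniform measure on the tangent sphere.
  have hdens (y : ℝ≥0) : ENNReal.ofReal (localIntensity d r / (alphaExp d * γ ^ (1 / alphaExp d)) *
      (y : ℝ) ^ (1 / alphaExp d - 1)) = ENNReal.ofReal (γ ^ (-(1 / alphaExp d)) * r * σ) *
      ENNReal.ofReal (2 ^ (((d - 1 : ℕ) : ℝ) / 2 - 1) * (y : ℝ) ^ (((d - 1 : ℕ) : ℝ) / 2 - 1)) := by
    rw [← ENNReal.ofReal_mul (by positivity), ← one_div_alphaExp hd]
    congr 1
    have hγ' : γ ^ (1 / alphaExp d) ≠ 0 := (Real.rpow_pos_of_pos hγ _).ne'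
    rw [localIntensity, ← hσ, Real.rpow_sub_one two_ne_zero, Real.rpow_neg hγ.le]
    have hα : alphaExp d * ((d : ℝ) - 1) = 2 := by
      rw [alphaExp, div_mul_cancel₀ _ hd1.ne']
    have hα0 := (alphaExp_pos hd).ne'
    rw [div_mul_eq_mul_div, div_eq_iff (by positivity), div_mul_eq_mul_div, div_mul_eq_mul_div,
      div_eq_iff hd1.ne']
    have hγγ := inv_mul_cancel₀ hγ'
    linear_combination (-(2 ^ (1 / alphaExp d) * σ * r * (y : ℝ) ^ (1 / alphaExp d - 1)) *
      (alphaExp d * ((d : ℝ) - 1)) / 2 : ℝ) * hγγ -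
      (2 ^ (1 / alphaExp d) * σ * r * (y : ℝ) ^ (1 / alphaExp d - 1) / 2 : ℝ) * hα
  rw [criticalIntensity, map_tangentPolar, hT, map_halfSq_volumeIoiPow (by omega : 1 ≤ d - 1)]
  simp_rw [hdens]
  have hwd := withDensity_smul (μ := (volume : Measure ℝ).comap ((↑) : ℝ≥0 → ℝ))
    (ENNReal.ofReal (γ ^ (-(1 / alphaExp d)) * r * σ))
    (f := fun y : ℝ≥0 => ENNReal.ofReal (2 ^ (((d - 1 : ℕ) : ℝ) / 2 - 1) *
      (y : ℝ) ^ (((d - 1 : ℕ) : ℝ) / 2 - 1))) (by fun_prop)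
  have hfun : (fun y : ℝ≥0 => ENNReal.ofReal (γ ^ (-(1 / alphaExp d)) * r * σ) *
      ENNReal.ofReal (2 ^ (((d - 1 : ℕ) : ℝ) / 2 - 1) * (y : ℝ) ^ (((d - 1 : ℕ) : ℝ) / 2 - 1))) =
      ENNReal.ofReal (γ ^ (-(1 / alphaExp d)) * r * σ) • fun y : ℝ≥0 =>
        ENNReal.ofReal (2 ^ (((d - 1 : ℕ) : ℝ) / 2 - 1) *
          (y : ℝ) ^ (((d - 1 : ℕ) : ℝ) / 2 - 1)) := rfl
  have hfin : IsFiniteMeasure (surfaceMeasure (tangentAt q)) := ⟨htop.lt_top⟩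
  rw [hfun, hwd, uniformTangent, Measure.prod_smul_left, Measure.prod_smul_right, smul_smul, hσT,
    ENNReal.ofReal_mul (by positivity), mul_assoc, ENNReal.mul_inv_cancel (hσT ▸ h0)
      ENNReal.ofReal_ne_top, mul_one]
  rfl

end Polar

/-! ### Integrals against the critical intensity and existence of its Poisson process. -/

section CriticalIntensity

variable {d : ℕ}

lemma continuous_criticalNumer (q : USphere d) : Continuous (criticalNumer q) := by
  unfold criticalNumer
  fun_prop

lemma continuous_criticalDenom (q : USphere d) : Continuous (criticalDenom q) := by
  unfold criticalDenom
  fun_prop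

lemma criticalDenom_tangentPolar (q : USphere d) (w : ({0}ᶜ : Set (tangentAt q))) :
    criticalDenom q (tangentPolar w) = Real.exp (-(‖(w : tangentAt q)‖ ^ 2 / 2)) := by
  rw [criticalDenom, coe_tangentPolar_fst]

/-- For `y = ‖w‖² / 2` and `θ = w / ‖w‖` the vector `√(2y) θ` is `w` itself. -/
lemma criticalNumer_tangentPolar (q : USphere d) (w : ({0}ᶜ : Set (tangentAt q))) :
    criticalNumer q (tangentPolar w) = Real.exp (-(‖(w : tangentAt q)‖ ^ 2 / 2)) •
      ((w : tangentAt q) : EuclideanSpace ℝ (Fin d)) := by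
  have hw : ‖(w : tangentAt q)‖ ≠ 0 := norm_ne_zero_iff.2 w.2
  rw [criticalNumer, coe_tangentPolar_fst, coe_tangentPolar_snd, Submodule.coe_smul, smul_smul,
    mul_div_cancel₀ _ (two_ne_zero), Real.sqrt_sq (norm_nonneg _), mul_assoc,
    mul_inv_cancel₀ hw, mul_one]

variable {F : Type*} [NormedAddCommGroup F]

lemma integrable_criticalIntensity (hd : 2 ≤ d) (q : USphere d) {γ r : ℝ} (hγ : 0 < γ)
    (hr : 0 ≤ r) {H : ℝ≥0 × TangentSphere q → F} (hH : StronglyMeasurable H) {G : tangentAt q → F}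
    (hG : ∀ w : ({0}ᶜ : Set (tangentAt q)), H (tangentPolar w) = G w)
    (hi : Integrable G volume) : Integrable H (criticalIntensity q γ r) := by
  rw [criticalIntensity_eq hd q hγ hr]
  refine Integrable.smul_measure ?_ ENNReal.ofReal_ne_top
  rw [integrable_map_measure hH.aestronglyMeasurable measurable_tangentPolar.aemeasurable]
  have h1 : H ∘ tangentPolar = G ∘ ((↑) : ({0}ᶜ : Set (tangentAt q)) → tangentAt q) :=
    funext hG
  rw [h1, ← integrableOn_iff_comap_subtypeVal (measurableSet_singleton _).compl]
  exact hi.integrableOn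

lemma integral_criticalIntensity [NormedSpace ℝ F] (hd : 2 ≤ d) (q : USphere d) {γ r : ℝ}
    (hγ : 0 < γ)
    (hr : 0 ≤ r) {H : ℝ≥0 × TangentSphere q → F} (hH : StronglyMeasurable H) {G : tangentAt q → F}
    (hG : ∀ w : ({0}ᶜ : Set (tangentAt q)), H (tangentPolar w) = G w) :
    ∫ z, H z ∂(criticalIntensity q γ r) = (γ ^ (-(1 / alphaExp d)) * r) • ∫ w, G w := by
  have : Nontrivial (tangentAt q) := Module.nontrivial_of_finrank_pos (R := ℝ) (by
    rw [finrank_tangentAt hd q]; omega)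
  rw [criticalIntensity_eq hd q hγ hr, integral_smul_measure, integral_map
    measurable_tangentPolar.aemeasurable hH.aestronglyMeasurable,
    ENNReal.toReal_ofReal (by positivity)]
  simp_rw [hG]
  rw [integral_subtype_comap (measurableSet_singleton _).compl, restrict_compl_singleton]

lemma criticalIntensity_fst_lt_ne_top (hd : 2 ≤ d) (q : USphere d) {γ r : ℝ} (hγ : 0 < γ)
    (hr : 0 ≤ r) (a : ℝ≥0) : criticalIntensity q γ r {z | z.1 < a} ≠ ∞ := by
  have hS : MeasurableSet {z : ℝ≥0 × TangentSphere q | z.1 < a} :=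
    measurableSet_lt measurable_fst measurable_const
  rw [criticalIntensity_eq hd q hγ hr, Measure.smul_apply, Measure.map_apply
    measurable_tangentPolar hS, smul_eq_mul, comap_subtype_coe_apply
    (measurableSet_singleton _).compl]
  refine ENNReal.mul_ne_top ENNReal.ofReal_ne_top ?_
  -- The radius is crude: `‖w‖² / 2 < a` gives `‖w‖ ≤ (‖w‖² + 1) / 2 < 2a + 1`.
  refine ((measure_mono ?_).trans_lt (measure_ball_lt_top (μ := (volume : Measure (tangentAt q)))
    (x := 0) (r := 2 * (a : ℝ) + 1))).ne
  rintro _ ⟨w, hw, rfl⟩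
  have h1 : (tangentPolar w).1 < a := hw
  rw [← NNReal.coe_lt_coe, coe_tangentPolar_fst] at h1
  rw [mem_ball_zero_iff]
  nlinarith [norm_nonneg (w : tangentAt q), sq_nonneg (‖(w : tangentAt q)‖ - 1)]

/-- Lebesgue measure on the tangent space is infinite. This is what excludes an empty process, and
with it a vanishing limiting denominator. -/
lemma criticalIntensity_univ (hd : 2 ≤ d) (q : USphere d) {γ r : ℝ} (hγ : 0 < γ)
    (hr : 0 < r) : criticalIntensity q γ r Set.univ = ∞ := by
  have : Nontrivial (tangentAt q) := Module.nontrivial_of_finrank_pos (R := ℝ) (by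
    rw [finrank_tangentAt hd q]; omega)
  have : NoncompactSpace (tangentAt q) := NormedSpace.noncompactSpace ℝ _
  rw [criticalIntensity_eq hd q hγ hr.le, Measure.smul_apply, Measure.map_apply
    measurable_tangentPolar .univ, smul_eq_mul, comap_subtype_coe_apply
    (measurableSet_singleton _).compl, Set.preimage_univ, Set.image_univ, Subtype.range_coe,
    measure_compl (measurableSet_singleton _) (by simp), measure_univ_of_isAddLeftInvariant]
  simp only [measure_singleton, tsub_zero]
  exact ENNReal.mul_top (ENNReal.ofReal_pos.2 (by positivity)).ne'

lemma sigmaFinite_criticalIntensity (hd : 2 ≤ d) (q : USphere d) {γ r : ℝ} (hγ : 0 < γ)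
    (hr : 0 ≤ r) : SigmaFinite (criticalIntensity q γ r) :=
  ⟨⟨{ set := fun k => {z | z.1 < (k : ℝ≥0)}
      set_mem := fun _ => trivial
      finite := fun k => (criticalIntensity_fst_lt_ne_top hd q hγ hr k).lt_top
      spanning := Set.iUnion_eq_univ_iff.2 fun z => exists_nat_gt z.1 }⟩⟩

lemma exists_poissonPointProcess_criticalIntensity (hd : 2 ≤ d) (q : USphere d) {γ r : ℝ}
    (hγ : 0 < γ) (hr : 0 ≤ r) :
    ∃ (Ω₀ : Type) (_ : MeasurableSpace Ω₀) (P₀ : Measure Ω₀) (_ : IsProbabilityMeasure P₀)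
      (M : Ω₀ → Measure (ℝ≥0 × TangentSphere q)),
      IsPoissonPointProcess P₀ (criticalIntensity q γ r) M := by
  have : Nontrivial (tangentAt q) := Module.nontrivial_of_finrank_pos (R := ℝ) (by
    rw [finrank_tangentAt hd q]; omega)
  have : Nonempty (TangentSphere q) := (NormedSpace.sphere_nonempty.2 zero_le_one).to_subtype
  -- The pieces are the slabs `k ≤ y < k + 1`; a bounded set meets only finitely many of them.
  refine exists_isPoissonPointProcess _ (fun k => {z | ⌊z.1⌋₊ = k}) (fun k => ?_)
    (fun i j hij => ?_) ?_ (fun k => ?_) (fun B hB => ?_)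
  · exact (Nat.measurable_floor.comp measurable_fst) (measurableSet_singleton k)
  · exact Set.disjoint_left.2 fun z hz hz' => hij (hz.symm.trans hz')
  · exact Set.iUnion_eq_univ_iff.2 fun z => ⟨_, rfl⟩
  · refine measure_ne_top_of_subset ?_ (criticalIntensity_fst_lt_ne_top hd q hγ hr (k + 1))
    rintro z (rfl : ⌊z.1⌋₊ = k)
    exact Nat.lt_floor_add_one z.1
  · obtain ⟨R, hR⟩ := (hB.image_fst).subset_closedBall 0
    refine ⟨⌊R⌋₊ + 1, fun k hk => Set.disjoint_left.2 ?_⟩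
    rintro z hz (rfl : ⌊z.1⌋₊ = k)
    have h1 := hR (Set.mem_image_of_mem _ hz)
    rw [mem_closedBall, NNReal.dist_eq] at h1
    simp only [NNReal.coe_zero, sub_zero, NNReal.abs_eq] at h1
    have h2 : (⌊z.1⌋₊ : ℝ) ≤ z.1 := by exact_mod_cast Nat.floor_le z.1.2
    have h3 := Nat.le_floor (h2.trans h1)
    omega

/-- The function `w ↦ e^{-‖w‖²/2}`, times a linear factor, is integrable. -/
lemma integrable_exp_neg_norm_sq_smul {V W : Type*} [NormedAddCommGroup V]
    [InnerProductSpace ℝ V] [FiniteDimensional ℝ V] [MeasurableSpace V] [BorelSpace V]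
    [NormedAddCommGroup W] [NormedSpace ℝ W] (L : V →L[ℝ] W) :
    Integrable (fun w : V => Real.exp (-(‖w‖ ^ 2 / 2)) • L w) := by
  refine ((integrable_exp_neg_mul_norm_sq (V := V) (b := 1 / 4) (by norm_num)).const_mul
    (2 * ‖L‖)).mono' (Continuous.aestronglyMeasurable (by fun_prop)) (ae_of_all _ fun w => ?_)
  rw [norm_smul, Real.norm_of_nonneg (Real.exp_pos _).le]
  -- Half of the Gaussian decay is spent on the linear factor, which leaves `e^{-‖w‖²/4}`.
  have h1 : ‖w‖ ≤ 2 * Real.exp (1 / 4 * ‖w‖ ^ 2) := by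
    nlinarith [Real.add_one_le_exp (1 / 4 * ‖w‖ ^ 2), sq_nonneg (‖w‖ - 1)]
  calc Real.exp (-(‖w‖ ^ 2 / 2)) * ‖L w‖
      ≤ Real.exp (-(‖w‖ ^ 2 / 2)) * (‖L‖ * (2 * Real.exp (1 / 4 * ‖w‖ ^ 2))) := by
        gcongr
        exact (L.le_opNorm w).trans (by gcongr)
    _ = 2 * ‖L‖ * (Real.exp (-(‖w‖ ^ 2 / 2)) * Real.exp (1 / 4 * ‖w‖ ^ 2)) := by ring
    _ = _ := by
        rw [← Real.exp_add]
        ring_nf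

lemma integrable_criticalNumer (hd : 2 ≤ d) (q : USphere d) {γ r : ℝ} (hγ : 0 < γ)
    (hr : 0 ≤ r) : Integrable (criticalNumer q) (criticalIntensity q γ r) :=
  integrable_criticalIntensity hd q hγ hr (continuous_criticalNumer q).stronglyMeasurable
    (criticalNumer_tangentPolar q) (integrable_exp_neg_norm_sq_smul (tangentAt q).subtypeL)

lemma integrable_criticalDenom (hd : 2 ≤ d) (q : USphere d) {γ r : ℝ} (hγ : 0 < γ)
    (hr : 0 ≤ r) : Integrable (criticalDenom q) (criticalIntensity q γ r) := by
  refine integrable_criticalIntensity hd q hγ hr (continuous_criticalDenom q).stronglyMeasurable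
    (G := fun w => Real.exp (-(‖w‖ ^ 2 / 2))) (criticalDenom_tangentPolar q) ?_
  refine (integrable_exp_neg_mul_norm_sq (b := 1 / 2) (by norm_num)).congr (ae_of_all _ fun w => ?_)
  ring_nf

end CriticalIntensity

/-! ### Scaling limits in the gnomonic chart. -/

section Scaling

variable {d : ℕ}

lemma distToQuery_gnomonic (q : USphere d) (v : tangentAt q) :
    distToQuery q (gnomonic q v) = 1 - ‖(q : EuclideanSpace ℝ (Fin d)) + v‖⁻¹ := by
  rw [distToQuery, inner_gnomonic]

lemma distToQuery_nonneg (q x : USphere d) : 0 ≤ distToQuery q x := by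
  have h : ⟪(q : EuclideanSpace ℝ (Fin d)), (x : EuclideanSpace ℝ (Fin d))⟫ ≤ 1 := by
    simpa using real_inner_le_norm (q : EuclideanSpace ℝ (Fin d)) (x : EuclideanSpace ℝ (Fin d))
  rw [distToQuery]
  linarith

lemma norm_sub_sq_eq_distToQuery (q x : USphere d) :
    ‖(x : EuclideanSpace ℝ (Fin d)) - q‖ ^ 2 = 2 * distToQuery q x := by
  rw [norm_sub_sq_real, real_inner_comm, distToQuery]
  simp
  ring

lemma continuous_distToQuery (q : USphere d) : Continuous (distToQuery q) := by
  unfold distToQuery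
  fun_prop

variable {ι : Type*} {l : Filter ι} {β : ι → ℝ}

lemma tendsto_inv_sqrt_smul (hβ : Tendsto β l atTop) {V : Type*} [NormedAddCommGroup V]
    [NormedSpace ℝ V] (v : V) : Tendsto (fun i => (√(β i))⁻¹ • v) l (𝓝 0) := by
  simpa using (tendsto_inv_atTop_zero.comp (Real.tendsto_sqrt_atTop.comp hβ)).smul_const v

lemma tendsto_norm_add_tangent (hβ : Tendsto β l atTop) (q : USphere d) (v : tangentAt q) :
    Tendsto (fun i => ‖(q : EuclideanSpace ℝ (Fin d)) + ((√(β i))⁻¹ • v : tangentAt q)‖) l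
      (𝓝 1) := by
  have h : Continuous fun v : tangentAt q => ‖(q : EuclideanSpace ℝ (Fin d)) + v‖ := by fun_prop
  have := (h.tendsto 0).comp (tendsto_inv_sqrt_smul hβ v)
  simpa [Function.comp_def] using this

/-- With `N = ‖q + v / √β‖`, Pythagoras gives `N² - 1 = ‖v‖² / β`, so `β (1 - N⁻¹) = ‖v‖² / (N (N +
1))`, and `N → 1`. -/
lemma tendsto_mul_distToQuery_gnomonic (hβ : Tendsto β l atTop) (q : USphere d)
    (v : tangentAt q) :
    Tendsto (fun i => β i * distToQuery q (gnomonic q ((√(β i))⁻¹ • v))) l (𝓝 (‖v‖ ^ 2 / 2)) := by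
  have hN := tendsto_norm_add_tangent hβ q v
  have h1 : Tendsto (fun i => ‖v‖ ^ 2 /
      (‖(q : EuclideanSpace ℝ (Fin d)) + ((√(β i))⁻¹ • v : tangentAt q)‖ *
        (‖(q : EuclideanSpace ℝ (Fin d)) + ((√(β i))⁻¹ • v : tangentAt q)‖ + 1))) l
      (𝓝 (‖v‖ ^ 2 / (1 * (1 + 1)))) :=
    tendsto_const_nhds.div (hN.mul (hN.add_const 1)) (by norm_num)
  norm_num at h1
  refine h1.congr' ?_
  filter_upwards [hβ.eventually_gt_atTop 0] with i hi
  have hp := norm_add_tangent_pos q ((√(β i))⁻¹ • v)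
  have hsq := norm_add_tangent_sq q ((√(β i))⁻¹ • v)
  rw [norm_smul, norm_inv, Real.norm_of_nonneg (Real.sqrt_nonneg _), mul_pow, inv_pow,
    Real.sq_sqrt hi.le] at hsq
  rw [distToQuery_gnomonic]
  simp only [Submodule.coe_smul] at hp hsq ⊢
  set N := ‖(q : EuclideanSpace ℝ (Fin d)) + (√(β i))⁻¹ • (v : EuclideanSpace ℝ (Fin d))‖
  have h2 : ‖(v : EuclideanSpace ℝ (Fin d))‖ ^ 2 = β i * (N ^ 2 - 1) := by
    rw [hsq, Submodule.coe_norm]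
    field_simp
    ring
  rw [h2]
  field_simp
  ring

/-- The rescaled difference is `N⁻¹ v - √β (1 - N⁻¹) q`. The radial coefficient is `(√β)⁻¹` times
the convergent quantity `β (1 - N⁻¹)`, hence vanishes in the limit. -/
lemma tendsto_sqrt_smul_gnomonic_sub (hβ : Tendsto β l atTop) (q : USphere d)
    (v : tangentAt q) :
    Tendsto (fun i => √(β i) • ((gnomonic q ((√(β i))⁻¹ • v) : EuclideanSpace ℝ (Fin d)) - q)) l
      (𝓝 (v : EuclideanSpace ℝ (Fin d))) := by
  have hN := (tendsto_norm_add_tangent hβ q v).inv₀ one_ne_zero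
  have h1 := hN.smul_const (v : EuclideanSpace ℝ (Fin d))
  have h2 := (((tendsto_inv_atTop_zero.comp (Real.tendsto_sqrt_atTop.comp hβ)).mul
    (tendsto_mul_distToQuery_gnomonic hβ q v)).smul_const (q : EuclideanSpace ℝ (Fin d)))
  have h3 := h1.sub h2
  simp only [inv_one, one_smul, zero_mul, zero_smul, sub_zero] at h3
  refine h3.congr' ?_
  filter_upwards [hβ.eventually_gt_atTop 0] with i hi
  have hs := Real.sqrt_pos.2 hi
  rw [distToQuery_gnomonic]
  simp only [Function.comp_apply, gnomonic, Submodule.coe_smul]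
  set N := ‖(q : EuclideanSpace ℝ (Fin d)) + (√(β i))⁻¹ • (v : EuclideanSpace ℝ (Fin d))‖
  have h4 : (√(β i))⁻¹ * (β i * (1 - N⁻¹)) = √(β i) * (1 - N⁻¹) := by
    nth_rewrite 2 [← Real.mul_self_sqrt hi.le]
    field_simp
  rw [h4, smul_sub, smul_smul, smul_add, smul_smul, mul_assoc, mul_comm N⁻¹, ← mul_assoc,
    mul_inv_cancel₀ hs.ne', one_mul]
  module

end Scaling

/-! ### The local intensity of keys near the query. -/

section LocalIntensity

variable {d : ℕ}

lemma integral_densityLaw {ρ : USphere d → ℝ} (hρ : Continuous ρ) (hρ0 : ∀ x, 0 ≤ ρ x)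
    {F : Type*} [NormedAddCommGroup F] [NormedSpace ℝ F] (f : USphere d → F) :
    ∫ x, f x ∂(densityLaw ρ) = ∫ x, ρ x • f x ∂(surfaceMeasure (EuclideanSpace ℝ (Fin d))) := by
  simp only [densityLaw, ENNReal.ofReal]
  rw [integral_withDensity_eq_integral_smul hρ.measurable.real_toNNReal]
  refine integral_congr_ae (ae_of_all _ fun x => ?_)
  simp only [NNReal.smul_def]
  rw [Real.coe_toNNReal _ (hρ0 x)]

lemma sqrt_pow_eq_rpow (hd : 2 ≤ d) {b : ℝ} (hb : 0 ≤ b) :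
    (√b) ^ (d - 1) = b ^ (1 / alphaExp d) := by
  rw [one_div_alphaExp hd, Real.sqrt_eq_rpow, ← Real.rpow_natCast, ← Real.rpow_mul hb]
  congr 1
  ring

/-- The ball `‖v‖² / 2 ≤ 1` is the limit of the caps of height `t` rescaled by `t^{-1/2}`; its
volume explains the constant in `localIntensity`. -/
lemma volume_real_closedBall_sqrt_two (hd : 2 ≤ d) (q : USphere d) :
    (volume : Measure (tangentAt q)).real (closedBall 0 (√2)) =
      2 ^ (1 / alphaExp d) * (surfaceMeasure (EuclideanSpace ℝ (Fin (d - 1)))).real Set.univ /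
        ((d : ℝ) - 1) := by
  have hT := finrank_tangentAt hd q
  have hd1 : (0 : ℝ) < (d : ℝ) - 1 := by
    have : (2 : ℝ) ≤ d := by exact_mod_cast hd
    linarith
  have h1 : (surfaceMeasure (EuclideanSpace ℝ (Fin (d - 1)))).real Set.univ =
      ((d : ℝ) - 1) * (volume : Measure (tangentAt q)).real (ball 0 1) := by
    rw [Measure.real, ← surfaceMeasure_tangentAt_univ hd q, surfaceMeasure, ← Measure.real,
      Measure.toSphere_real_apply_univ, hT, Nat.cast_sub (by omega), Nat.cast_one]
  rw [h1, Measure.real, Measure.addHaar_closedBall _ _ (Real.sqrt_nonneg _), hT,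
    sqrt_pow_eq_rpow hd zero_le_two, ENNReal.toReal_mul, ENNReal.toReal_ofReal (by positivity),
    Measure.real]
  field_simp

/-- Near the query, the distance-to-query of a key has a regularly varying distribution. -/
theorem tendsto_densityLaw_distToQuery (hd : 2 ≤ d) (q : USphere d) {ρ : USphere d → ℝ}
    (hρ : Continuous ρ) (hρ0 : ∀ x, 0 ≤ ρ x) :
    Tendsto (fun t : ℝ => (densityLaw ρ).real {y | distToQuery q y ≤ t} *
        t ^ (-(1 / alphaExp d))) (𝓝[>] 0) (𝓝 (localIntensity d (ρ q))) := by
  have hT := finrank_tangentAt hd q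
  have hE : Module.finrank ℝ (EuclideanSpace ℝ (Fin d)) = (d - 1) + 1 := by
    rw [finrank_euclideanSpace_fin]; omega
  have hA (t : ℝ) : MeasurableSet {y : USphere d | distToQuery q y ≤ t} :=
    measurableSet_le (continuous_distToQuery q).measurable measurable_const
  have hβ : Tendsto (fun t : ℝ => t⁻¹) (𝓝[>] 0) atTop := tendsto_inv_nhdsGT_zero
  have hpos : ∀ᶠ t : ℝ in 𝓝[>] 0, 0 < t := self_mem_nhdsWithin
  have key := tendsto_integral_sphere_localization q hE hT hρ hβ
    (g := fun t x => {y : USphere d | distToQuery q y ≤ t}.indicator (fun _ => (1 : ℝ)) x)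
    -- The scale is `β = t⁻¹`. On the cap `β (1 - ⟪q, x⟫) ≤ 1`, so its indicator is at most `e ·
    -- e^{-β (1 - ⟪q, x⟫)}`.
    (fun t => stronglyMeasurable_const.indicator (hA t)) (C := Real.exp 1) (c := 1) one_pos
    (by
      filter_upwards [hpos] with t ht x
      by_cases hx : distToQuery q x ≤ t
      · rw [Set.indicator_of_mem (show x ∈ {y | distToQuery q y ≤ t} from hx), norm_one,
          ← Real.exp_add]
        refine Real.one_le_exp ?_
        have : t⁻¹ * distToQuery q x ≤ 1 := by
          rw [inv_mul_le_iff₀ ht]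
          linarith
        rw [distToQuery] at this
        linarith
      · rw [Set.indicator_of_notMem (show x ∉ {y | distToQuery q y ≤ t} from hx), norm_zero]
        positivity)
    (G := (closedBall (0 : tangentAt q) (√2)).indicator fun _ => (1 : ℝ))
    (by
      have hnull : ∀ᵐ v : tangentAt q, v ∉ sphere (0 : tangentAt q) (√2) :=
        -- On the boundary sphere `‖v‖ = √2` the indicators need not converge, but it is a null set.
        measure_eq_zero_iff_ae_notMem.1
          (Measure.addHaar_sphere_of_ne_zero volume 0 (Real.sqrt_ne_zero'.2 two_pos))
      filter_upwards [hnull] with v hv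
      have hlim := tendsto_mul_distToQuery_gnomonic hβ q v
      have hiff (t : ℝ) (ht : 0 < t) (x : USphere d) :
          distToQuery q x ≤ t ↔ t⁻¹ * distToQuery q x ≤ 1 := by
        rw [inv_mul_le_iff₀ ht, mul_one]
      rw [mem_sphere_zero_iff_norm] at hv
      refine tendsto_const_nhds.congr' ?_
      rcases lt_or_gt_of_ne hv with h | h
      · have h2 : ‖v‖ ^ 2 / 2 < 1 := by
          rw [Real.lt_sqrt (norm_nonneg _)] at h
          linarith
        filter_upwards [hlim.eventually_lt_const h2, hpos] with t ht1 ht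
        rw [Set.indicator_of_mem (by simpa using h.le), Set.indicator_of_mem]
        exact (hiff t ht _).2 ht1.le
      · have h2 : 1 < ‖v‖ ^ 2 / 2 := by
          rw [Real.sqrt_lt' ((Real.sqrt_nonneg 2).trans_lt h)] at h
          linarith
        filter_upwards [hlim.eventually_const_lt h2, hpos] with t ht1 ht
        rw [Set.indicator_of_notMem (by simpa using h), Set.indicator_of_notMem]
        exact fun hmem => not_le.2 ht1 ((hiff t ht _).1 hmem))
  have hlimval : ρ q • ∫ v : tangentAt q, (closedBall (0 : tangentAt q) (√2)).indicator
      (fun _ => (1 : ℝ)) v = localIntensity d (ρ q) := by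
    rw [integral_indicator measurableSet_closedBall, setIntegral_const, smul_eq_mul, smul_eq_mul,
      mul_one, volume_real_closedBall_sqrt_two hd q, localIntensity, mul_comm]
  rw [hlimval] at key
  refine key.congr' ?_
  filter_upwards [hpos] with t ht
  rw [sqrt_pow_eq_rpow hd (by positivity), Real.inv_rpow ht.le, ← Real.rpow_neg ht.le, smul_eq_mul,
    mul_comm]
  congr 1
  have h1 := integral_densityLaw hρ hρ0
    ({y : USphere d | distToQuery q y ≤ t}.indicator fun _ => (1 : ℝ))
  rw [integral_indicator (hA t), setIntegral_const, smul_eq_mul, mul_one] at h1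
  exact h1.symm

end LocalIntensity

/-! ### Mapping theorem and convergence of the characteristic exponents. -/

section Limit

/-- The mapping theorem for convergence in distribution, for functions which are almost surely
continuous at the limit. -/
theorem MeasureTheory.TendstoInDistribution.comp_of_ae_continuousAt {ι Ω Ω' E F : Type*}
    [MeasurableSpace Ω] [MeasurableSpace Ω'] {P : Measure Ω} [IsProbabilityMeasure P]
    {P' : Measure Ω'} [IsProbabilityMeasure P'] [PseudoEMetricSpace E] [MeasurableSpace E]
    [BorelSpace E] [PseudoEMetricSpace F] [MeasurableSpace F] [BorelSpace F] {l : Filter ι}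
    [l.IsCountablyGenerated] {X : ι → Ω → E} {Z : Ω' → E}
    (h : TendstoInDistribution X l Z (fun _ => P) P') {g : E → F} (hg : Measurable g)
    (hc : ∀ᵐ ω ∂P', ContinuousAt g (Z ω)) :
    TendstoInDistribution (fun i ω => g (X i ω)) l (fun ω => g (Z ω)) (fun _ => P) P' := by
  refine ⟨fun i => hg.comp_aemeasurable (h.forall_aemeasurable i),
    hg.comp_aemeasurable h.aemeasurable_limit, ?_⟩
  refine tendsto_of_forall_isClosed_limsup_le' fun A hA => ?_
  -- Portmanteau is applied to the closure of the preimage of `A`: a continuity point of `g` in this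
  -- closure is mapped into `A`, so the closure adds no mass in the limit.
  have h1 := ProbabilityMeasure.limsup_measure_closed_le_of_tendsto h.tendsto
    (isClosed_closure (s := g ⁻¹' A))
  simp only [ProbabilityMeasure.coe_mk] at h1 ⊢
  have h2 : limsup (fun i => (P.map fun ω => g (X i ω)) A) l ≤
      limsup (fun i => (P.map (X i)) (closure (g ⁻¹' A))) l := by
    refine limsup_le_limsup (Eventually.of_forall fun i => ?_)
    beta_reduce
    rw [Measure.map_apply_of_aemeasurable
      (show AEMeasurable (fun ω => g (X i ω)) P from
        hg.comp_aemeasurable (h.forall_aemeasurable i))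
      hA.measurableSet, Measure.map_apply_of_aemeasurable (h.forall_aemeasurable i)
      isClosed_closure.measurableSet]
    exact measure_mono fun ω hω => subset_closure hω
  refine h2.trans (h1.trans ?_)
  rw [Measure.map_apply_of_aemeasurable
    (show AEMeasurable (fun ω => g (Z ω)) P' from hg.comp_aemeasurable h.aemeasurable_limit)
    hA.measurableSet, Measure.map_apply_of_aemeasurable h.aemeasurable_limit
    isClosed_closure.measurableSet]
  refine measure_mono_ae ?_
  filter_upwards [hc] with ω hω hmem
  have h3 := hω.continuousWithinAt (s := g ⁻¹' A) |>.mem_closure_image hmem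
  exact hA.closure_subset_iff.2 (Set.image_preimage_subset g A) h3

/-- If `c n • Y n` converges in distribution and `c n → ∞`, then `Y n → 0` in probability. -/
theorem MeasureTheory.TendstoInDistribution.tendstoInMeasure_zero_of_smul {Ω Ω' E : Type*}
    [MeasurableSpace Ω] [MeasurableSpace Ω'] {P : Measure Ω} [IsProbabilityMeasure P]
    {P' : Measure Ω'} [IsProbabilityMeasure P'] [NormedAddCommGroup E] [NormedSpace ℝ E]
    [SecondCountableTopology E] [MeasurableSpace E] [BorelSpace E]
    {Y : ℕ → Ω → E} {Z : Ω' → E} {c : ℕ → ℝ} (hc : Tendsto c atTop atTop)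
    (h : TendstoInDistribution (fun n ω => c n • Y n ω) atTop Z (fun _ => P) P') :
    TendstoInMeasure P Y atTop (fun _ => 0) := by
  -- Slutsky: multiplying by `(c n)⁻¹ → 0` gives the limit `0`, and convergence in law to a constant
  -- is convergence in probability by portmanteau on `{ε ≤ edist y 0}`.
  have h1 := h.continuous_comp_prodMk_of_tendstoInMeasure_const
    (g := fun p : E × ℝ => p.2 • p.1) (by fun_prop) (Y := fun n _ => (c n)⁻¹) (c := 0)
    (tendstoInMeasure_of_tendsto_ae (fun _ => aestronglyMeasurable_const)
      (ae_of_all _ fun _ => tendsto_inv_atTop_zero.comp hc)) (fun _ => aemeasurable_const)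
  intro ε hε
  have hA : IsClosed {y : E | ε ≤ edist y 0} := isClosed_le continuous_const (by fun_prop)
  have h2 := ProbabilityMeasure.limsup_measure_closed_le_of_tendsto h1.tendsto hA
  simp only [ProbabilityMeasure.coe_mk] at h2
  have h3 : (P'.map fun ω => (0 : ℝ) • Z ω) {y : E | ε ≤ edist y 0} = 0 := by
    rw [Measure.map_apply_of_aemeasurable h1.aemeasurable_limit hA.measurableSet]
    simp [hε.not_ge]
  rw [h3] at h2
  have h4 := tendsto_of_le_liminf_of_limsup_le (a := 0) bot_le h2
  refine h4.congr' ?_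
  filter_upwards [hc.eventually_gt_atTop 0] with n hn
  rw [Measure.map_apply_of_aemeasurable (h1.forall_aemeasurable n) hA.measurableSet]
  simp [smul_smul, hn.ne']

variable {d : ℕ}

/-- The contribution of a key `x` to the rescaled numerator and to the denominator. -/
def keyVector (β : ℝ) (q x : USphere d) : WithLp 2 (EuclideanSpace ℝ (Fin d) × ℝ) :=
  WithLp.toLp 2 (Real.exp (-(β * distToQuery q x)) • √β •
    ((x : EuclideanSpace ℝ (Fin d)) - q), Real.exp (-(β * distToQuery q x)))

lemma continuous_keyVector (β : ℝ) (q : USphere d) : Continuous (keyVector β q) := by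
  have := continuous_distToQuery q
  unfold keyVector
  fun_prop

/-- This is the exponential envelope required by the localization. For `y = β (1 - ⟪q, x⟫)` the
vector `√β (x - q)` has length `√(2y)`, and `e^{-y} √(2y) ≤ e^{-y/2}` because `2y ≤ e y ≤ e^y`. -/
lemma abs_inner_keyVector_le {β : ℝ} (hβ : 0 ≤ β) (q x : USphere d)
    (t : WithLp 2 (EuclideanSpace ℝ (Fin d) × ℝ)) :
    |⟪keyVector β q x, t⟫| ≤ (‖t.fst‖ + ‖t.snd‖) *
      Real.exp (-(1 / 2) * (β * distToQuery q x)) := by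
  set y := β * distToQuery q x with hy
  have hy0 : 0 ≤ y := mul_nonneg hβ (distToQuery_nonneg q x)
  have hnorm : ‖√β • ((x : EuclideanSpace ℝ (Fin d)) - q)‖ = √(2 * y) := by
    rw [norm_smul, Real.norm_of_nonneg (Real.sqrt_nonneg _), eq_comm, hy,
      show 2 * (β * distToQuery q x) = β * (2 * distToQuery q x) by ring,
      ← norm_sub_sq_eq_distToQuery, Real.sqrt_mul hβ, Real.sqrt_sq (norm_nonneg _)]
  have hexp : Real.exp (-y) * √(2 * y) ≤ Real.exp (-(1 / 2) * y) := by
    have h1 : √(2 * y) ≤ Real.exp (y / 2) := by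
      rw [Real.sqrt_le_left (Real.exp_pos _).le, ← Real.exp_nat_mul]
      have h2 : ((2 : ℕ) : ℝ) * (y / 2) = (y - 1) + 1 := by push_cast; ring
      rw [h2, Real.exp_add]
      nlinarith [Real.add_one_le_exp (y - 1), Real.add_one_le_exp (1 : ℝ), Real.exp_pos (y - 1)]
    calc Real.exp (-y) * √(2 * y) ≤ Real.exp (-y) * Real.exp (y / 2) := by gcongr
      _ = _ := by rw [← Real.exp_add]; ring_nf
  have hexp' : Real.exp (-y) ≤ Real.exp (-(1 / 2) * y) := Real.exp_le_exp.2 (by linarith)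
  rw [WithLp.prod_inner_apply]
  simp only [keyVector, ← hy]
  refine (abs_add_le _ _).trans ?_
  have h1 : |⟪Real.exp (-y) • √β • ((x : EuclideanSpace ℝ (Fin d)) - q), t.fst⟫| ≤
      Real.exp (-(1 / 2) * y) * ‖t.fst‖ := by
    refine (abs_real_inner_le_norm _ _).trans ?_
    rw [norm_smul, hnorm, Real.norm_of_nonneg (Real.exp_pos _).le]
    gcongr
  have h2 : |⟪Real.exp (-y), t.snd⟫| ≤ Real.exp (-(1 / 2) * y) * ‖t.snd‖ := by
    refine (abs_real_inner_le_norm _ _).trans ?_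
    rw [Real.norm_of_nonneg (Real.exp_pos _).le]
    gcongr
  exact (add_le_add h1 h2).trans_eq (by ring)

/-- The limit of the rescaled contributions, in the tangent space. -/
def tangentVector (q : USphere d) (w : tangentAt q) : WithLp 2 (EuclideanSpace ℝ (Fin d) × ℝ) :=
  WithLp.toLp 2 (Real.exp (-(‖w‖ ^ 2 / 2)) • (w : EuclideanSpace ℝ (Fin d)),
    Real.exp (-(‖w‖ ^ 2 / 2)))

lemma tendsto_keyVector_gnomonic {ι : Type*} {l : Filter ι} {β : ι → ℝ} (hβ : Tendsto β l atTop)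
    (q : USphere d) (w : tangentAt q) :
    Tendsto (fun i => keyVector (β i) q (gnomonic q ((√(β i))⁻¹ • w))) l
      (𝓝 (tangentVector q w)) := by
  have h1 := (Real.continuous_exp.tendsto _).comp (tendsto_mul_distToQuery_gnomonic hβ q w).neg
  have h2 := h1.smul (tendsto_sqrt_smul_gnomonic_sub hβ q w)
  exact ((WithLp.prod_continuous_toLp 2 _ _).tendsto _).comp (h2.prodMk_nhds h1)

/-- The integrands of the limit, as one vector. -/
def criticalVector (q : USphere d) (z : ℝ≥0 × TangentSphere q) :
    WithLp 2 (EuclideanSpace ℝ (Fin d) × ℝ) :=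
  WithLp.toLp 2 (criticalNumer q z, criticalDenom q z)

lemma continuous_criticalVector (q : USphere d) : Continuous (criticalVector q) := by
  have h1 := continuous_criticalNumer q
  have h2 := continuous_criticalDenom q
  unfold criticalVector
  fun_prop

lemma criticalVector_tangentPolar (q : USphere d) (w : ({0}ᶜ : Set (tangentAt q))) :
    criticalVector q (tangentPolar w) = tangentVector q w := by
  rw [criticalVector, criticalNumer_tangentPolar, criticalDenom_tangentPolar, tangentVector]

lemma tendsto_atTop_of_tendsto_mul_rpow (hd : 2 ≤ d) {β : ℕ → ℝ} {γ : ℝ} (hγ : 0 < γ)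
    (hβ : Tendsto (fun n : ℕ => β n * (n : ℝ) ^ (-alphaExp d)) atTop (𝓝 γ)) :
    Tendsto β atTop atTop := by
  have h1 : Tendsto (fun n : ℕ => (n : ℝ) ^ alphaExp d) atTop atTop :=
    (tendsto_rpow_atTop (alphaExp_pos hd)).comp tendsto_natCast_atTop_atTop
  refine (hβ.pos_mul_atTop hγ h1).congr' ?_
  filter_upwards [eventually_gt_atTop 0] with n hn
  have hn' : (0 : ℝ) < n := by exact_mod_cast hn
  rw [mul_assoc, ← Real.rpow_add hn', neg_add_cancel, Real.rpow_zero, mul_one]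

/-- Here criticality enters: since `1/α = (d - 1)/2`, the quotient equals `(β n^{-α})^{-1/α}`. It
compares the number of keys with the inverse volume of the relevant neighbourhood of `q`. -/
lemma tendsto_natCast_div_sqrt_pow (hd : 2 ≤ d) {β : ℕ → ℝ} {γ : ℝ} (hγ : 0 < γ)
    (hβ : Tendsto (fun n : ℕ => β n * (n : ℝ) ^ (-alphaExp d)) atTop (𝓝 γ)) :
    Tendsto (fun n : ℕ => (n : ℝ) / (√(β n)) ^ (d - 1)) atTop (𝓝 (γ ^ (-(1 / alphaExp d)))) := by
  have hβ' := tendsto_atTop_of_tendsto_mul_rpow hd hγ hβ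
  refine (hβ.rpow_const (p := -(1 / alphaExp d)) (Or.inl hγ.ne')).congr' ?_
  filter_upwards [eventually_gt_atTop 0, hβ'.eventually_gt_atTop 0] with n hn hb
  have hn' : (0 : ℝ) < n := by exact_mod_cast hn
  have hα := (alphaExp_pos hd).ne'
  rw [sqrt_pow_eq_rpow hd hb.le, Real.mul_rpow hb.le (by positivity), ← Real.rpow_mul hn'.le,
    Real.rpow_neg hb.le, neg_mul_neg, mul_one_div_cancel hα, Real.rpow_one, mul_comm,
    ← div_eq_mul_inv]

/-- Convergence of the rescaled characteristic exponents of a single key. -/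
lemma tendsto_natCast_mul_integral_keyVector (hd : 2 ≤ d) (q : USphere d) {ρ : USphere d → ℝ}
    (hρ : Continuous ρ) (hρ0 : ∀ x, 0 ≤ ρ x) {β : ℕ → ℝ} {γ : ℝ} (hγ : 0 < γ)
    (hβ : Tendsto (fun n : ℕ => β n * (n : ℝ) ^ (-alphaExp d)) atTop (𝓝 γ))
    (t : WithLp 2 (EuclideanSpace ℝ (Fin d) × ℝ)) :
    Tendsto (fun n : ℕ => (n : ℂ) * ∫ x, (Complex.exp (⟪keyVector (β n) q x, t⟫ * Complex.I) - 1)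
        ∂(densityLaw ρ)) atTop
      (𝓝 (∫ z, (Complex.exp (⟪criticalVector q z, t⟫ * Complex.I) - 1)
        ∂(criticalIntensity q γ (ρ q)))) := by
  have hT := finrank_tangentAt hd q
  have hE : Module.finrank ℝ (EuclideanSpace ℝ (Fin d)) = (d - 1) + 1 := by
    rw [finrank_euclideanSpace_fin]; omega
  have hβ' := tendsto_atTop_of_tendsto_mul_rpow hd hγ hβ
  have key := tendsto_integral_sphere_localization q hE hT hρ hβ'
    (g := fun n x => Complex.exp (⟪keyVector (β n) q x, t⟫ * Complex.I) - 1)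
    (fun n => by
      have := continuous_keyVector (β n) q
      exact Continuous.stronglyMeasurable (by fun_prop))
    (C := ‖t.fst‖ + ‖t.snd‖) (c := 1 / 2) (by norm_num)
    (by
      filter_upwards [hβ'.eventually_ge_atTop 0] with n hn x
      exact (IsPoissonPointProcess.norm_exp_ofReal_mul_I_sub_one_le _).trans
        (abs_inner_keyVector_le hn q x t))
    (G := fun w => Complex.exp (⟪tangentVector q w, t⟫ * Complex.I) - 1)
    (ae_of_all _ fun w => by
      have h1 : Continuous fun z : WithLp 2 (EuclideanSpace ℝ (Fin d) × ℝ) =>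
          Complex.exp (⟪z, t⟫ * Complex.I) - 1 := by fun_prop
      exact (h1.tendsto _).comp (tendsto_keyVector_gnomonic hβ' q w))
  rw [integral_criticalIntensity hd q hγ (hρ0 q)
    (G := fun w => Complex.exp (⟪tangentVector q w, t⟫ * Complex.I) - 1)
    (Continuous.stronglyMeasurable (by have := continuous_criticalVector q; fun_prop))
    (fun w => by rw [criticalVector_tangentPolar]), mul_smul]
  refine ((tendsto_natCast_div_sqrt_pow hd hγ hβ).smul key).congr' ?_
  filter_upwards [hβ'.eventually_gt_atTop 0] with n hn
  have hs : (√(β n)) ^ (d - 1) ≠ 0 := pow_ne_zero _ (Real.sqrt_pos.2 hn).ne'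
  rw [integral_densityLaw hρ hρ0, smul_smul, div_mul_cancel₀ _ hs, Complex.real_smul,
    Complex.ofReal_natCast]
  rfl

end Limit

/-! ### Joint limit of numerator and denominator, and softmax attention. -/

section Attention

variable {d : ℕ} {Ω Ω' : Type*} [MeasurableSpace Ω] [MeasurableSpace Ω']

lemma IsC2OnSphere.continuous {hd : 2 ≤ d} {ρ : USphere d → ℝ} (hρ : IsC2OnSphere d hd ρ) :
    Continuous ρ := by
  have : Fact (Module.finrank ℝ (EuclideanSpace ℝ (Fin d)) = (d - 1) + 1) :=
    ⟨by rw [finrank_euclideanSpace_fin]; omega⟩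
  exact ContMDiff.continuous (show ContMDiff (𝓡 (d - 1)) 𝓘(ℝ, ℝ) 2 ρ from hρ)

/-- The numerator and denominator of the limiting ratio, as one vector. -/
def criticalSum (q : USphere d) (μ : Measure (ℝ≥0 × TangentSphere q)) :
    WithLp 2 (EuclideanSpace ℝ (Fin d) × ℝ) :=
  WithLp.toLp 2 (∫ z, criticalNumer q z ∂μ, ∫ z, criticalDenom q z ∂μ)

section Poisson

variable {P' : Measure Ω'} {q : USphere d} {γ r : ℝ}
  {M : Ω' → Measure (ℝ≥0 × TangentSphere q)}

/-- The numerator and denominator of the limiting ratio converge, and the latter is positive. -/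
lemma IsPoissonPointProcess.ae_integrable_critical [IsProbabilityMeasure P'] (hd : 2 ≤ d)
    (hγ : 0 < γ) (hr : 0 < r)
    (hM : IsPoissonPointProcess P' (criticalIntensity q γ r) M) :
    ∀ᵐ ω ∂P', Integrable (criticalNumer q) (M ω) ∧ Integrable (criticalDenom q) (M ω) ∧
      0 < ∫ z, criticalDenom q z ∂(M ω) := by
  have := sigmaFinite_criticalIntensity hd q hγ hr.le
  filter_upwards [hM.ae_integrable (continuous_criticalNumer q).measurable
      (integrable_criticalNumer hd q hγ hr.le),
    hM.ae_integrable (continuous_criticalDenom q).measurable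
      (integrable_criticalDenom hd q hγ hr.le),
    hM.ae_ne_zero (criticalIntensity_univ hd q hγ hr)] with ω h1 h2 h3
  refine ⟨h1, h2, (integral_pos_iff_support_of_nonneg (f := criticalDenom q)
    (fun z => (Real.exp_pos _).le) h2).2 ?_⟩
  have h4 : Function.support (criticalDenom q) = Set.univ :=
    Set.eq_univ_of_forall fun z => (Real.exp_pos _).ne'
  rw [h4]
  exact Measure.measure_univ_pos.2 h3

lemma IsPoissonPointProcess.aemeasurable_criticalSum (hd : 2 ≤ d) (hγ : 0 < γ) (hr : 0 ≤ r)
    (hM : IsPoissonPointProcess P' (criticalIntensity q γ r) M) :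
    AEMeasurable (fun ω => criticalSum q (M ω)) P' := by
  have := sigmaFinite_criticalIntensity hd q hγ hr
  exact (WithLp.measurable_toLp 2 _).comp_aemeasurable
    ((hM.aemeasurable_integral_euclidean (continuous_criticalNumer q).measurable
      (integrable_criticalNumer hd q hγ hr)).prodMk
    (hM.aemeasurable_integral (continuous_criticalDenom q).measurable
      (integrable_criticalDenom hd q hγ hr)))

/-- Pairing with `t` commutes with the integrals, so this is the characteristic functional at the
scalar function `⟪criticalVector q ·, t⟫`. -/
lemma IsPoissonPointProcess.charFun_criticalSum [IsProbabilityMeasure P'] (hd : 2 ≤ d)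
    (hγ : 0 < γ) (hr : 0 ≤ r)
    (hM : IsPoissonPointProcess P' (criticalIntensity q γ r) M)
    (t : WithLp 2 (EuclideanSpace ℝ (Fin d) × ℝ)) :
    charFun (P'.map fun ω => criticalSum q (M ω)) t =
      Complex.exp (∫ z, (Complex.exp (⟪criticalVector q z, t⟫ * Complex.I) - 1)
        ∂(criticalIntensity q γ r)) := by
  have := sigmaFinite_criticalIntensity hd q hγ hr
  have hN := integrable_criticalNumer hd q hγ hr
  have hD := integrable_criticalDenom hd q hγ hr
  have hinner (z) : ⟪criticalVector q z, t⟫ =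
      ⟪criticalNumer q z, t.fst⟫ + ⟪criticalDenom q z, t.snd⟫ := WithLp.prod_inner_apply ..
  have hm : Measurable fun z => ⟪criticalVector q z, t⟫ := by
    have := continuous_criticalVector q
    exact Continuous.measurable (by fun_prop)
  have hi : Integrable (fun z => ⟪criticalVector q z, t⟫) (criticalIntensity q γ r) := by
    simp_rw [hinner]
    exact (hN.inner_const _).add (hD.inner_const _)
  rw [charFun_apply, integral_map (hM.aemeasurable_criticalSum hd hγ hr)
    (by exact Continuous.aestronglyMeasurable (by fun_prop)), ← hM.integral_exp_integral hm hi]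
  refine integral_congr_ae ?_
  filter_upwards [hM.ae_integrable (continuous_criticalNumer q).measurable hN,
    hM.ae_integrable (continuous_criticalDenom q).measurable hD] with ω h1 h2
  have h3 : ∫ z, ⟪criticalVector q z, t⟫ ∂(M ω) = ⟪criticalSum q (M ω), t⟫ := by
    simp_rw [hinner]
    rw [integral_add (h1.inner_const _) (h2.inner_const _), WithLp.prod_inner_apply]
    congr 1
    · simp_rw [real_inner_comm t.fst]
      exact (integral_inner (𝕜 := ℝ) h1 _).trans (real_inner_comm _ _)
    · simp_rw [real_inner_comm t.snd]
      exact (integral_inner (𝕜 := ℝ) h2 _).trans (real_inner_comm _ _)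
  rw [h3]

end Poisson

section Keys

variable {P : Measure Ω} {ρ : USphere d → ℝ}

/-- The factor is written as `1 +` an integral so that the limit `(1 + a/n)^n → e^a` applies. -/
lemma charFun_map_sum_keyVector {n : ℕ} {x : Fin n → Ω → USphere d}
    [IsProbabilityMeasure (densityLaw ρ)]
    (hlaw : ∀ i, HasLaw (x i) (densityLaw ρ) P) (hindep : iIndepFun x P) (β : ℝ) (q : USphere d)
    (t : WithLp 2 (EuclideanSpace ℝ (Fin d) × ℝ)) :
    charFun (P.map fun ω => ∑ i, keyVector β q (x i ω)) t =
      (1 + ∫ y, (Complex.exp (⟪keyVector β q y, t⟫ * Complex.I) - 1) ∂(densityLaw ρ)) ^ n := by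
  have hk := continuous_keyVector β q
  have hm (i : Fin n) : AEMeasurable (fun ω => keyVector β q (x i ω)) P :=
    hk.measurable.comp_aemeasurable (hlaw i).aemeasurable
  have hind : iIndepFun (fun i ω => keyVector β q (x i ω)) P :=
    hindep.comp (fun _ => keyVector β q) fun _ => hk.measurable
  rw [hind.charFun_map_fun_sum_eq_prod hm, Finset.prod_apply]
  have hc : Continuous fun y => Complex.exp (⟪keyVector β q y, t⟫ * Complex.I) := by fun_prop
  have hone (i : Fin n) : charFun (P.map fun ω => keyVector β q (x i ω)) t =
      1 + ∫ y, (Complex.exp (⟪keyVector β q y, t⟫ * Complex.I) - 1) ∂(densityLaw ρ) := by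
    have hint : Integrable (fun y => Complex.exp (⟪keyVector β q y, t⟫ * Complex.I))
        (densityLaw ρ) :=
      .of_bound hc.aestronglyMeasurable 1
        (ae_of_all _ fun y => (Complex.norm_exp_ofReal_mul_I _).le)
    rw [integral_sub hint (integrable_const _), integral_const, probReal_univ, one_smul,
      add_sub_cancel, charFun_apply, integral_map (hm i)
        (by exact Continuous.aestronglyMeasurable (by fun_prop)),
      ← (hlaw i).map_eq, integral_map (hlaw i).aemeasurable hc.aestronglyMeasurable]
  simp_rw [hone]
  rw [Finset.prod_const, Finset.card_univ, Fintype.card_fin]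

/-- The rescaled numerators and denominators of softmax attention converge in distribution. -/
theorem tendstoInDistribution_sum_keyVector [IsProbabilityMeasure P] (hd : 2 ≤ d) {q : USphere d}
    (hρ : Continuous ρ)
    (hρ0 : ∀ x, 0 ≤ ρ x) {x : (n : ℕ) → Fin n → Ω → USphere d}
    (hlaw : ∀ n i, HasLaw (x n i) (densityLaw ρ) P) (hindep : ∀ n, iIndepFun (x n) P)
    {β : ℕ → ℝ} {γ : ℝ} (hγ : 0 < γ)
    (hβ : Tendsto (fun n : ℕ => β n * (n : ℝ) ^ (-alphaExp d)) atTop (𝓝 γ))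
    {P' : Measure Ω'} [IsProbabilityMeasure P'] {M : Ω' → Measure (ℝ≥0 × TangentSphere q)}
    (hM : IsPoissonPointProcess P' (criticalIntensity q γ (ρ q)) M) :
    TendstoInDistribution (fun n ω => ∑ i, keyVector (β n) q (x n i ω)) atTop
      (fun ω => criticalSum q (M ω)) (fun _ => P) P' := by
  have : IsProbabilityMeasure (densityLaw ρ) := by
    -- The single key of the sample of size one shows that `ρ dσ` has total mass one.
    rw [← (hlaw 1 0).map_eq]
    exact Measure.isProbabilityMeasure_map (hlaw 1 0).aemeasurable
  refine ⟨fun n => Finset.aemeasurable_fun_sum _ fun i _ =>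
      (continuous_keyVector (β n) q).measurable.comp_aemeasurable (hlaw n i).aemeasurable,
    hM.aemeasurable_criticalSum hd hγ (hρ0 q), ?_⟩
  refine ProbabilityMeasure.tendsto_of_tendsto_charFun fun t => ?_
  simp only [ProbabilityMeasure.coe_mk]
  rw [hM.charFun_criticalSum hd hγ (hρ0 q)]
  simp_rw [charFun_map_sum_keyVector (hlaw _) (hindep _)]
  exact Complex.tendsto_one_add_pow_exp_of_tendsto
    (tendsto_natCast_mul_integral_keyVector hd q hρ hρ0 hγ hβ t)

end Keys

/-- The ratio of the components of a vector, transformed by the value matrix. -/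
def valueRatio (V : Matrix (Fin d) (Fin d) ℝ) (z : WithLp 2 (EuclideanSpace ℝ (Fin d) × ℝ)) :
    EuclideanSpace ℝ (Fin d) :=
  V.toEuclideanLin (z.snd⁻¹ • z.fst)

lemma measurable_valueRatio (V : Matrix (Fin d) (Fin d) ℝ) : Measurable (valueRatio V) := by
  have h1 : Measurable fun z : WithLp 2 (EuclideanSpace ℝ (Fin d) × ℝ) => z.fst :=
    Continuous.measurable (by fun_prop)
  have h2 : Measurable fun z : WithLp 2 (EuclideanSpace ℝ (Fin d) × ℝ) => z.snd :=
    Continuous.measurable (by fun_prop)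
  exact V.toEuclideanLin.continuous_of_finiteDimensional.measurable.comp (h2.inv.smul h1)

lemma continuousAt_valueRatio (V : Matrix (Fin d) (Fin d) ℝ)
    {z : WithLp 2 (EuclideanSpace ℝ (Fin d) × ℝ)} (hz : z.snd ≠ 0) :
    ContinuousAt (valueRatio V) z := by
  have h1 : Continuous fun z : WithLp 2 (EuclideanSpace ℝ (Fin d) × ℝ) => z.fst := by fun_prop
  have h2 : Continuous fun z : WithLp 2 (EuclideanSpace ℝ (Fin d) × ℝ) => z.snd := by fun_prop
  exact V.toEuclideanLin.continuous_of_finiteDimensional.continuousAt.comp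
    ((h2.continuousAt.inv₀ hz).smul h1.continuousAt)

/-- Softmax is invariant under adding a constant to all exponents, here `-β`. -/
lemma attnWeight_eq {n : ℕ} (β : ℝ) (q : USphere d) (x : Fin n → USphere d) (j : Fin n) :
    attnWeight β q x j = (∑ l, Real.exp (-(β * distToQuery q (x l))))⁻¹ *
      Real.exp (-(β * distToQuery q (x j))) := by
  have h (l : Fin n) : Real.exp (-(β * distToQuery q (x l))) = Real.exp (-β) *
      Real.exp (β * ⟪(q : EuclideanSpace ℝ (Fin d)), (x l : EuclideanSpace ℝ (Fin d))⟫) := by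
    rw [← Real.exp_add, distToQuery]
    ring_nf
  simp_rw [h]
  rw [← Finset.mul_sum, attnWeight, mul_inv, mul_mul_mul_comm, inv_mul_cancel₀ (Real.exp_ne_zero _),
    one_mul, div_eq_inv_mul]

/-- The rescaled displacement is the ratio of the sums of the contributions of the keys. -/
lemma sqrt_smul_attnDisplacement_eq {n : ℕ} (hn : n ≠ 0) (V : Matrix (Fin d) (Fin d) ℝ) (β : ℝ)
    (q : USphere d) (x : Fin n → USphere d) :
    √β • attnDisplacement V β q x = valueRatio V (∑ i, keyVector β q (x i)) := by
  -- With no keys the two sides differ: the displacement is `-V q`, while the ratio is `0` by the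
  -- convention `0⁻¹ = 0`.
  have : NeZero n := ⟨hn⟩
  set S := ∑ l, Real.exp (-(β * distToQuery q (x l))) with hS
  have hS0 : S ≠ 0 := (Finset.sum_pos (fun l _ => Real.exp_pos _) Finset.univ_nonempty).ne'
  have hfst : (∑ i, keyVector β q (x i)).fst =
      ∑ i, Real.exp (-(β * distToQuery q (x i))) • √β • ((x i : EuclideanSpace ℝ (Fin d)) - q) :=
    map_sum (WithLp.fstₗ 2 ℝ (EuclideanSpace ℝ (Fin d)) ℝ) _ _
  have hsnd : (∑ i, keyVector β q (x i)).snd = S :=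
    map_sum (WithLp.sndₗ 2 ℝ (EuclideanSpace ℝ (Fin d)) ℝ) _ _
  rw [valueRatio, hfst, hsnd, attnDisplacement, attnOutput, ← map_sub, ← map_smul]
  congr 1
  simp_rw [attnWeight_eq, ← hS, mul_smul]
  rw [← Finset.smul_sum]
  simp_rw [smul_comm _ (√β), ← Finset.smul_sum, smul_sub, Finset.sum_sub_distrib, ← Finset.sum_smul]
  rw [← hS, smul_comm _ (√β), smul_sub, smul_sub, smul_smul S⁻¹ S, inv_mul_cancel₀ hS0, one_smul]

lemma continuous_attnDisplacement {n : ℕ} (V : Matrix (Fin d) (Fin d) ℝ) (β : ℝ) (q : USphere d) :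
    Continuous (attnDisplacement (n := n) V β q) := by
  have h (j : Fin n) : Continuous fun x : Fin n → USphere d => attnWeight β q x j := by
    refine Continuous.div (by fun_prop) (by fun_prop) fun x => ?_
    exact (Finset.sum_pos (fun l _ => Real.exp_pos _) ⟨j, Finset.mem_univ j⟩).ne'
  have hV := V.toEuclideanLin.continuous_of_finiteDimensional
  exact (hV.comp (by fun_prop)).sub continuous_const

/-- The rescaled displacement of softmax attention converges in distribution in the critical
regime. -/
theorem tendstoInDistribution_attnDisplacement {P : Measure Ω} [IsProbabilityMeasure P]
    (hd : 2 ≤ d) {q : USphere d} (V : Matrix (Fin d) (Fin d) ℝ) {ρ : USphere d → ℝ}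
    (hρ : Continuous ρ) (hρ0 : ∀ x, 0 ≤ ρ x) (hρq : 0 < ρ q)
    {x : (n : ℕ) → Fin n → Ω → USphere d}
    (hlaw : ∀ n i, HasLaw (x n i) (densityLaw ρ) P) (hindep : ∀ n, iIndepFun (x n) P)
    {β : ℕ → ℝ} {γ : ℝ} (hγ : 0 < γ)
    (hβ : Tendsto (fun n : ℕ => β n * (n : ℝ) ^ (-alphaExp d)) atTop (𝓝 γ))
    {P' : Measure Ω'} [IsProbabilityMeasure P'] {M : Ω' → Measure (ℝ≥0 × TangentSphere q)}
    (hM : IsPoissonPointProcess P' (criticalIntensity q γ (ρ q)) M) :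
    TendstoInDistribution
      (fun (n : ℕ) (ω : Ω) => √(β n) • attnDisplacement V (β n) q (fun i => x n i ω)) atTop
      (fun ω => V.toEuclideanLin (criticalRatio q (M ω))) (fun _ => P) P' := by
  have h := (tendstoInDistribution_sum_keyVector hd hρ hρ0 hlaw hindep hγ hβ
    hM).comp_of_ae_continuousAt (measurable_valueRatio V) (by
      filter_upwards [hM.ae_integrable_critical hd hγ hρq] with ω hω
      exact continuousAt_valueRatio V hω.2.2.ne')
  -- The identification with the ratio fails at `n = 0`, so measurability is shown directly for all
  -- `n` and the laws are matched only eventually.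
  refine ⟨fun n => ?_, h.aemeasurable_limit, h.tendsto.congr' ?_⟩
  · exact ((continuous_attnDisplacement V (β n) q).measurable.comp_aemeasurable
      (aemeasurable_pi_lambda _ fun i => (hlaw n i).aemeasurable)).const_smul (√(β n))
  · filter_upwards [eventually_ne_atTop 0] with n hn
    exact Subtype.ext (by simp_rw [sqrt_smul_attnDisplacement_eq hn])

/-- The displacement of softmax attention tends to zero in probability in the critical regime. -/
theorem tendstoInMeasure_attnDisplacement {P : Measure Ω} [IsProbabilityMeasure P]
    (hd : 2 ≤ d) {q : USphere d} (V : Matrix (Fin d) (Fin d) ℝ) {ρ : USphere d → ℝ}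
    (hρ : Continuous ρ) (hρ0 : ∀ x, 0 ≤ ρ x) (hρq : 0 < ρ q)
    {x : (n : ℕ) → Fin n → Ω → USphere d}
    (hlaw : ∀ n i, HasLaw (x n i) (densityLaw ρ) P) (hindep : ∀ n, iIndepFun (x n) P)
    {β : ℕ → ℝ} {γ : ℝ} (hγ : 0 < γ)
    (hβ : Tendsto (fun n : ℕ => β n * (n : ℝ) ^ (-alphaExp d)) atTop (𝓝 γ)) :
    TendstoInMeasure P (fun (n : ℕ) (ω : Ω) => attnDisplacement V (β n) q (fun i => x n i ω))
      atTop (fun _ => 0) := by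
  -- No process is given here; the constructed one supplies the limit law needed for the Slutsky
  -- argument.
  obtain ⟨Ω₀, _, P₀, _, M, hM⟩ := exists_poissonPointProcess_criticalIntensity hd q hγ (hρ0 q)
  exact (tendstoInDistribution_attnDisplacement hd V hρ hρ0 hρq hlaw hindep hγ hβ
    hM).tendstoInMeasure_zero_of_smul
      (Real.tendsto_sqrt_atTop.comp (tendsto_atTop_of_tendsto_mul_rpow hd hγ hβ))

end Attention

end

theorem theorem4p2 {Ω Ω' : Type*} [MeasurableSpace Ω] [MeasurableSpace Ω']
    (d : ℕ) (hd : 2 ≤ d) (q : USphere d) (V : Matrix (Fin d) (Fin d) ℝ)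
    (ρ : USphere d → ℝ) (hρC2 : IsC2OnSphere d hd ρ) (hρ0 : ∀ x, 0 ≤ ρ x) (hρq : 0 < ρ q)
    (P : Measure Ω) [IsProbabilityMeasure P]
    (x : (n : ℕ) → Fin n → Ω → USphere d)
    (hlaw : ∀ n i, HasLaw (x n i) (densityLaw ρ) P)
    (hindep : ∀ n, iIndepFun (x n) P)
    (β : ℕ → ℝ) (γ : ℝ) (hγ : 0 < γ)
    (hβ : Tendsto (fun n : ℕ => β n * (n : ℝ) ^ (-alphaExp d)) atTop (𝓝 γ)) :
    -- the local intensity is the limit of `F(t) t^{-1/α}`, `F` the distribution function of the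
    -- distance-to-query of a key
    Tendsto (fun t : ℝ => (densityLaw ρ).real {y | distToQuery q y ≤ t} *
        t ^ (-(1 / alphaExp d))) (𝓝[>] 0) (𝓝 (localIntensity d (ρ q))) ∧
    -- the Poisson process exists
    (∃ (Ω₀ : Type) (_ : MeasurableSpace Ω₀) (P₀ : Measure Ω₀) (_ : IsProbabilityMeasure P₀)
        (M : Ω₀ → Measure (ℝ≥0 × TangentSphere q)),
        IsPoissonPointProcess P₀ (criticalIntensity q γ (ρ q)) M) ∧
    -- for every such process the ratio is well defined and gives the limit law
    (∀ (P' : Measure Ω') [IsProbabilityMeasure P'] (M : Ω' → Measure (ℝ≥0 × TangentSphere q)),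
        IsPoissonPointProcess P' (criticalIntensity q γ (ρ q)) M →
        (∀ᵐ ω ∂P', Integrable (criticalNumer q) (M ω) ∧ Integrable (criticalDenom q) (M ω) ∧
          0 < ∫ z, criticalDenom q z ∂(M ω)) ∧
        TendstoInDistribution
          (fun (n : ℕ) (ω : Ω) => √(β n) • attnDisplacement V (β n) q (fun i => x n i ω)) atTop
          (fun ω => V.toEuclideanLin (criticalRatio q (M ω))) (fun _ => P) P') ∧
    -- convergence in probability of the displacement and of the output
    TendstoInMeasure P (fun (n : ℕ) (ω : Ω) => attnDisplacement V (β n) q (fun i => x n i ω))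
      atTop (fun _ => 0) ∧
    TendstoInMeasure P (fun (n : ℕ) (ω : Ω) => attnOutput V (β n) q (fun i => x n i ω))
      atTop (fun _ => V.toEuclideanLin (q : EuclideanSpace ℝ (Fin d))) := by
  have hρ := hρC2.continuous
  have hdisp := tendstoInMeasure_attnDisplacement hd V hρ hρ0 hρq hlaw hindep hγ hβ
  refine ⟨tendsto_densityLaw_distToQuery hd q hρ hρ0,
    exists_poissonPointProcess_criticalIntensity hd q hγ (hρ0 q), fun P' _ M hM =>
    ⟨hM.ae_integrable_critical hd hγ hρq,
      tendstoInDistribution_attnDisplacement hd V hρ hρ0 hρq hlaw hindep hγ hβ hM⟩, hdisp, ?_⟩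
  intro ε hε
  refine (hdisp ε hε).congr fun n => ?_
  simp only [attnDisplacement, edist_eq_enorm_sub, sub_zero]
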